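/- Let $A$ be a nonempty finite set of actions and $C=\Delta(A)\subset\mathbb{R}^A$ the simplex of probability distributions on $A$, with the Euclidean norm; identify $a\in A$ with the corresponding unit vector of $C$. A scoring rule is a function $L:A\times C\to\mathbb{R}$, extended by $L(d,c)=\sum_{a}d(a)L(a,c)$ for $d,c\in C$; it is proper if $L(d,c)\ge L(d,d)$ for all $c,d\in C$, and $1$-bounded if $\|\mathbf{L}(c)-\mathbf{L}(c')\|\le 1$ for all $c,c'\in C$, where $\mathbf{L}(c)=(L(a,c))_{a\in A}$. Let $\mathcal{L}_1$ be the class of $1$-bounded proper scoring rules, and put $D^L(d,c)=L(d,c)-L(d,d)$. For $t\ge 1$, actions $\mathbf a_t=(a_s)_{s\le t}$, forecasts $\mathbf c_t=(c_s)_{s\le t}$ in $C$ and a sequence of bins $\mathbf i_t=(i_s)_{s\le t}$, let $\bar a_t(i)$ be the average of the $a_s$ over the periods $s\le t$ with $i_s=i$, and $$\mathcal{B}_t^L(\mathbf c)=\frac1t\sum_{s=1}^tD^L(a_s,c_s),\quad \mathcal{R}_t^L(\mathbf i)=\frac1t\sum_{s=1}^tD^L(a_s,\bar a_t(i_s)),\quad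 \mathcal{K}_t^L(\mathbf c)=\frac1t\sum_{s=1}^tD^L(\bar a_t(c_s),c_s),$$ where in $\mathcal{K}_t^L(\mathbf c)$ the bins are the forecasts, i.e. $\mathbf i=\mathbf c$. Let $\mathbf b\times\mathbf c=((b_s,c_s))_s$ denote the joint binning. Let $B$ be a finite set, let $\delta>0$, and let $C_\delta\subset C$ be a finite $\delta$-grid of $C$, i.e., every point of $C$ is within distance $\delta$ of a point of $C_\delta$. A stochastic $\mathbf b$-based $C_\delta$-forecasting procedure $\zeta$ assigns, for each $t\ge1$, to every $(\mathbf a_{t-1},\mathbf c_{t-1},\mathbf b_t)\in A^{t-1}\times C^{t-1}\times B^{t}$ a probability distribution on $C_\delta$, according to which $c_t$ is drawn; $\mathbb{E}$ is the expectation over these random forecasts along given sequences $\mathbf a_t$ and $\mathbf b_t$. It is $\delta$-almost deterministic if the support of each of these distributions is included in some ball of radius $\delta$. Then there exists a stochastic $\mathbf b$-based $C_\delta$-forecasting procedure $\zeta$ that is $\delta$-almost deterministic and satisfies, for all $t\ge1$, all sequences $\mathbf a_t\in A^t$ and $\mathbf b_t\in B^t$, and all $L\in\mathcal{L}_1$,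 $$\mathbb{E}\left[\mathcal{B}_t^L(\mathbf c)-\mathcal{R}_t^L(\mathbf b\times\mathbf c)\right]\le\left(\delta^2+2|B|\,|C_\delta|\frac{\ln t+1}{t}\right)^{1/2},$$ $$\mathbb{E}\left[\mathcal{B}_t^L(\mathbf c)-\mathcal{R}_t^L(\mathbf b)\right]\le\left(\delta^2+2|B|\,|C_\delta|\frac{\ln t+1}{t}\right)^{1/2},$$ $$\mathbb{E}\left[\mathcal{K}_t^L(\mathbf c)\right]=\mathbb{E}\left[\mathcal{B}_t^L(\mathbf c)-\mathcal{R}_t^L(\mathbf c)\right]\le\left(\delta^2+2|B|\,|C_\delta|\frac{\ln t+1}{t}\right)^{1/2}.$$ Moreover, $\zeta$ is $(\sqrt\delta,B)$-proper-calibeating and $\sqrt\delta$-proper-calibrated, i.e., $$\limsup_{t\to\infty}\ \sup_{L\in\mathcal{L}_1}\ \sup_{\mathbf a_t\in A^t,\,\mathbf b_t\in B^t}\mathbb{E}\left[\mathcal{B}_t^L(\mathbf c)-\mathcal{R}_t^L(\mathbf b)\right]\le\delta\quad\text{and}\quad\limsup_{t\to\infty}\ \sup_{L\in\mathcal{L}_1}\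 \sup_{\mathbf a_t\in A^t,\,\mathbf b_t\in B^t}\mathbb{E}\left[\mathcal{K}_t^L(\mathbf c)\right]\le\delta.$$ -/

import Mathlib

open Filter

namespace Forecast

/-- The set `C = Δ(A)` of forecasts: the probability distributions on the finite set `A`,
as a subset of the Euclidean space `ℝ^A` (so `dist` on it is the Euclidean distance). -/
abbrev Simplex (A : Type*) [Fintype A] : Type _ :=
  {c : EuclideanSpace ℝ A // (∀ a, 0 ≤ c a) ∧ ∑ a, c a = 1}

section Scoring

variable {A : Type*} [Fintype A]

open Classical in
/-- The action `a`, identified with the unit vector of `Δ(A)`. -/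
noncomputable def vertex (a : A) : Simplex A :=
  ⟨EuclideanSpace.single a 1, by
    intro x
    by_cases h : x = a <;> simp [h], by simp⟩

/-- The linear extension `L(d, c) = ∑ a, d(a) L(a, c)` of a scoring rule `L : A × C → ℝ`. -/
def expLoss (L : A → Simplex A → ℝ) (d c : Simplex A) : ℝ :=
  ∑ a, d.1 a * L a c

/-- The vector `(L(a, c))_{a ∈ A}` in the Euclidean space `ℝ^A`. -/
def lossVec (L : A → Simplex A → ℝ) (c : Simplex A) : EuclideanSpace ℝ A :=
  WithLp.toLp 2 (fun a => L a c)

/-- `L` is proper: forecasting the true distribution minimizes the expected loss. -/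
def IsProper (L : A → Simplex A → ℝ) : Prop :=
  ∀ c d : Simplex A, expLoss L d d ≤ expLoss L d c

/-- `L` is `M`-bounded. -/
def IsBoundedBy (M : ℝ) (L : A → Simplex A → ℝ) : Prop :=
  ∀ c c' : Simplex A, ‖lossVec L c - lossVec L c'‖ ≤ M

/-- The `L`-divergence `D(d, c) = L(d, c) - L(d, d)`. -/
def divergence (L : A → Simplex A → ℝ) (d c : Simplex A) : ℝ :=
  expLoss L d c - expLoss L d d

end Scoring

section Scores

variable {A : Type*} [Fintype A] {I : Type*} {t : ℕ}

open Classical in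
/-- The set of periods that are assigned to bin `j`. -/
noncomputable def binPeriods (i : Fin t → I) (j : I) : Finset (Fin t) :=
  Finset.univ.filter (fun s => i s = j)

/-- The number `n_t(j)` of entries in bin `j`. -/
noncomputable def binCount (i : Fin t → I) (j : I) : ℕ := (binPeriods i j).card

theorem binCount_pos (i : Fin t → I) (s : Fin t) : 0 < binCount i (i s) :=
  Finset.card_pos.mpr ⟨s, by simp [binPeriods]⟩

/-- The average action `ā_t(j)` in a nonempty bin `j`, a point of `Δ(A)`. -/
noncomputable def binMean (a : Fin t → A) (i : Fin t → I) (j : I) (hj : 0 < binCount i j) :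
    Simplex A :=
  ⟨(binCount i j : ℝ)⁻¹ • ∑ s ∈ binPeriods i j, (vertex (a s)).1, by
    intro x
    have : 0 ≤ ∑ s ∈ binPeriods i j, (vertex (a s)).1 x :=
      Finset.sum_nonneg fun s _ => (vertex (a s)).2.1 x
    simp only [PiLp.smul_apply, WithLp.ofLp_sum, Finset.sum_apply, smul_eq_mul]
    positivity, by
    have hne : (binCount i j : ℝ) ≠ 0 := by exact_mod_cast hj.ne'
    simp only [PiLp.smul_apply, WithLp.ofLp_sum, Finset.sum_apply, smul_eq_mul]
    rw [← Finset.mul_sum, Finset.sum_comm,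
      Finset.sum_congr rfl (fun s _ => (vertex (a s)).2.2), Finset.sum_const, nsmul_eq_mul, mul_one]
    exact inv_mul_cancel₀ hne⟩

/-- The `L`-Brier score `B_t^L(c)`, for the actions `a` and the forecasts `c`. -/
noncomputable def brierScore (L : A → Simplex A → ℝ) (a : Fin t → A) (c : Fin t → Simplex A) :
    ℝ :=
  (1 / (t : ℝ)) * ∑ s, divergence L (vertex (a s)) (c s)

/-- The `L`-calibration score `K_t^L(c; i)` with respect to the binning sequence `i`. -/
noncomputable def calibrationScore (L : A → Simplex A → ℝ) (a : Fin t → A)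
    (c : Fin t → Simplex A) (i : Fin t → I) : ℝ :=
  (1 / (t : ℝ)) * ∑ s, divergence L (binMean a i (i s) (binCount_pos i s)) (c s)

/-- The `L`-refinement score `R_t^L(i)` of the binning sequence `i`. -/
noncomputable def refinementScore (L : A → Simplex A → ℝ) (a : Fin t → A) (i : Fin t → I) : ℝ :=
  (1 / (t : ℝ)) * ∑ s, divergence L (vertex (a s)) (binMean a i (i s) (binCount_pos i s))

/-- The joint binning sequence `b × c`. -/
def jointBin {J : Type*} (b : Fin t → I) (c : Fin t → J) : Fin t → I × J := fun s => (b s, c s)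

end Scores

section Procedures

/-- A (stochastic) `b`-based forecasting procedure. In period `n + 1` the distribution of the
forecast depends on the actions and forecasts of the first `n` periods and on the reference
forecasts `b_1, …, b_{n+1}`. Distributions on `C` are discrete (`PMF`); this includes all
distributions with finite support. -/
def Procedure (A : Type*) [Fintype A] (B : Type*) : Type _ :=
  ∀ n : ℕ, (Fin n → A) → (Fin n → Simplex A) → (Fin (n + 1) → B) → PMF (Simplex A)

variable {A : Type*} [Fintype A] {B : Type*}

/-- The law of the forecasts `c_1, …, c_t` that `ζ` generates along the action sequence
`a_1, …, a_t` and the reference sequence `b_1, …, b_t`. -/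
noncomputable def forecastLaw (ζ : Procedure A B) :
    ∀ t : ℕ, (Fin t → A) → (Fin t → B) → PMF (Fin t → Simplex A)
  | 0, _, _ => PMF.pure Fin.elim0
  | t + 1, a, b =>
      (forecastLaw ζ t (fun s => a s.castSucc) (fun s => b s.castSucc)).bind fun c =>
        (ζ t (fun s => a s.castSucc) c b).map fun x =>
          (Fin.snoc (α := fun _ => Simplex A) c x : Fin (t + 1) → Simplex A)

/-- The expectation of `F(c_1, …, c_t)` over the random forecasts of `ζ`. -/
noncomputable def expectation (ζ : Procedure A B) {t : ℕ} (a : Fin t → A) (b : Fin t → B)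
    (F : (Fin t → Simplex A) → ℝ) : ℝ :=
  ∑' c : Fin t → Simplex A, (forecastLaw ζ t a b c).toReal * F c

/-- `D` is a `δ`-grid of `Δ(A)`: every point of `Δ(A)` is within distance `δ` of a point of `D`. -/
def IsGrid (δ : ℝ) (D : Finset (Simplex A)) : Prop :=
  ∀ x : Simplex A, ∃ d ∈ D, dist x d ≤ δ

/-- `ζ` is a `D`-forecasting procedure: all its forecasts belong to `D`. -/
def Procedure.ForecastsIn (ζ : Procedure A B) (D : Finset (Simplex A)) : Prop :=
  ∀ n a c b, (ζ n a c b).support ⊆ (D : Set (Simplex A))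

/-- `ζ` is `δ`-almost deterministic: each randomization is supported in a ball of radius `δ`. -/
def Procedure.IsAlmostDeterministic (ζ : Procedure A B) (δ : ℝ) : Prop :=
  ∀ n a c b, ∃ y : Simplex A, (ζ n a c b).support ⊆ Metric.closedBall y δ

/-- The class of `1`-bounded proper scoring rules. -/
def properOne (A : Type*) [Fintype A] : Set (A → Simplex A → ℝ) :=
  {L | IsProper L ∧ IsBoundedBy 1 L}

/-- `ζ` is `(ε, B)`-proper-calibeating. The suprema and the upper limit are taken in the
extended reals. -/
def Procedure.IsProperCalibeating (ζ : Procedure A B) (ε : ℝ) : Prop :=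
  limsup (fun t : ℕ => ⨆ L ∈ properOne A, ⨆ (a : Fin t → A) (b : Fin t → B),
    ((expectation ζ a b (fun c => brierScore L a c - refinementScore L a b) : ℝ) : EReal)) atTop
    ≤ ((ε ^ 2 : ℝ) : EReal)

/-- `ζ` is `ε`-proper-calibrated, with the calibration score taken with respect to the standard
binning by forecasts, uniformly over the action and the reference sequences. -/
def Procedure.IsProperCalibrated (ζ : Procedure A B) (ε : ℝ) : Prop :=
  limsup (fun t : ℕ => ⨆ L ∈ properOne A, ⨆ (a : Fin t → A) (b : Fin t → B),
    ((expectation ζ a b (fun c => calibrationScore L a c c) : ℝ) : EReal)) atTop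
    ≤ ((ε ^ 2 : ℝ) : EReal)

end Procedures

end Forecast

/-!
# Calibeating with proper scoring rules by an almost deterministic procedure

For a binning at least as fine as the forecasts, the excess of the Brier score over the refinement
score is the calibration score of that binning (`Forecast.brierScore_sub_refinementScore`). For a
`1`-bounded proper scoring rule the divergence `D(d, c)` is at most `⟨d - c, 𝐋(c) - 𝐋(d)⟩`, hence
at most `‖d - c‖` (`Forecast.divergence_le_norm_sub`), so the calibration score of the joint
binning is bounded by the root of its quadratic counterpart, and by Jensen's inequality it
suffices to bound the expectation of the latter by `δ ^ 2 + 2 |B| |D| (log t + 1) / t` for the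
grid `D`. The other bounds follow because coarser binnings have larger refinement scores.

The quadratic calibration score of the joint binning is, up to the factor `1 / t`, a sum over bins.
When the action `a` is added to a bin with forecast `x`, mean `g` and `n` entries, its term grows by
`‖a - x‖ ^ 2 - ‖a - g‖ ^ 2 + ‖a - g‖ ^ 2 / (n + 1)`. The last summand adds up to at most twice a
harmonic number in each bin. The difference of the first two is at most `δ ^ 2` on average if the
forecast is drawn from a suitable distribution on the grid points in a ball of radius `δ`
(`Forecast.exists_outgoing_weights`): if `y` is the centre of the ball, then
`‖a - x‖ ^ 2 - ‖a - g‖ ^ 2 ≤ ‖y - x‖ ^ 2 + 2 ⟨a - y, g - x⟩`, and one needs the mean of `g - x` to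
be in the normal cone of the simplex at `y`.

Such `y` and weights come from a variational inequality for a continuous vector field
(`exists_variational_stdSimplex`), applied to partitions of unity subordinate to slightly larger
balls, and a limit. The variational inequality is a consequence of Brouwer's theorem
(`exists_fixedPoint_stdSimplex`), which in turn is derived from Scarf's combinatorial lemma on
rankings of a finite set (`Scarf.exists_dominant_colorful`): a parity argument which needs no
triangulation. Fine grids in the simplex, ranked by their coordinates, are coloured by a coordinate
which the map does not decrease; a dominant set on which all colours occur has small diameter.
-/

/-! ### Scarf's combinatorial lemma -/

namespace Scarf

variable {V I : Type*}

/-- A set `S` is dominant for the family of rankings `q i` if no point is ranked strictly above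
the minimum of `S` by every `q i`. -/
def IsDominant (q : I → V → ℕ) (S : Finset V) : Prop :=
  ∀ y, ∃ i, ∀ x ∈ S, q i y ≤ q i x

theorem IsDominant.mono {q : I → V → ℕ} {S S' : Finset V} (h : IsDominant q S) (hS : S' ⊆ S) :
    IsDominant q S' := fun y =>
  let ⟨i, hi⟩ := h y
  ⟨i, fun x hx => hi x (hS hx)⟩

variable [Fintype I]

open Classical in
/-- A nonempty dominant set with one element less than there are rankings lies in exactly two
dominant sets with one more element, provided that for every `k` some point is ranked strictly
above its minimum by all rankings other than `k`. Taking minima maps the rankings onto `S` with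
exactly one collision `k₁`, `k₂`; an added point has to be the new minimum of `q k₁` or `q k₂`, and
it is the point ranked highest by this `q k` among those above the old minima of the others. -/
theorem card_dominant_insert [Fintype V] {q : I → V → ℕ} (hq : ∀ i, Function.Injective (q i))
    {S : Finset V} (hS : IsDominant q S) (hcard : S.card + 1 = Fintype.card I)
    (hne : S.Nonempty) (hM : ∀ k, ∃ z, ∀ i, i ≠ k → ∃ x ∈ S, q i x < q i z) :
    (Finset.univ.filter fun y => y ∉ S ∧ IsDominant q (insert y S)).card = 2 := by
  have hm : ∀ i, ∃ x ∈ S, ∀ x' ∈ S, q i x ≤ q i x' := fun i => S.exists_min_image (q i) hne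
  choose m hmS hmin using hm
  have hsurj : ∀ x ∈ S, ∃ i, m i = x := by
    intro x hx
    obtain ⟨i, hi⟩ := hS x
    exact ⟨i, hq i (le_antisymm (hmin i x hx) (hi _ (hmS i)))⟩
  obtain ⟨k₁, -, k₂, -, hk, hmk⟩ := Finset.exists_ne_map_eq_of_card_lt_of_maps_to
    (s := Finset.univ) (t := S) (f := m) (by rw [Finset.card_univ]; omega) (fun i _ => hmS i)
  -- Deleting either of the two colliding indices leaves `m` surjective.
  have hsurj' : ∀ k, k = k₁ ∨ k = k₂ → ∀ x ∈ S, ∃ i, i ≠ k ∧ m i = x := by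
    intro k hkk x hx
    obtain ⟨i, hi⟩ := hsurj x hx
    by_cases hik : i = k
    · rcases hkk with rfl | rfl
      · exact ⟨k₂, hk.symm, by rw [← hmk, ← hik, hi]⟩
      · exact ⟨k₁, hk, by rw [hmk, ← hik, hi]⟩
    · exact ⟨i, hik, hi⟩
  have hM' : ∀ k, ∃ z, ∀ i, i ≠ k → q i (m i) < q i z := by
    intro k
    obtain ⟨z, hz⟩ := hM k
    refine ⟨z, fun i hi => ?_⟩
    obtain ⟨x, hx, hxz⟩ := hz i hi
    exact (hmin i x hx).trans_lt hxz
  have hmax : ∀ k, ∃ y, (∀ i, i ≠ k → q i (m i) < q i y) ∧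
      ∀ z, (∀ i, i ≠ k → q i (m i) < q i z) → q k z ≤ q k y := by
    intro k
    obtain ⟨y, hy, hy'⟩ := Finset.exists_max_image
      (Finset.univ.filter fun z => ∀ i, i ≠ k → q i (m i) < q i z) (q k)
      (by obtain ⟨z, hz⟩ := hM' k; exact ⟨z, by simpa using hz⟩)
    exact ⟨y, by simpa using hy, fun z hz => hy' z (by simpa using hz)⟩
  choose Y hY hYmax using hmax
  have hYlt : ∀ k, ∀ x ∈ S, q k (Y k) ≤ q k x := by
    intro k x hx
    obtain ⟨i, hi⟩ := hS (Y k)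
    by_cases hik : i = k
    · exact hik ▸ hi x hx
    · exact absurd (hi _ (hmS i)) (not_le.2 (hY k i hik))
  have hYS : ∀ k, k = k₁ ∨ k = k₂ → Y k ∉ S := by
    intro k hkk hmem
    obtain ⟨i, hik, hi⟩ := hsurj' k hkk _ hmem
    exact absurd (hY k i hik) (by rw [hi]; exact lt_irrefl _)
  have hset : (Finset.univ.filter fun y => y ∉ S ∧ IsDominant q (insert y S)) = {Y k₁, Y k₂} := by
    ext y
    simp only [Finset.mem_filter, Finset.mem_univ, true_and, Finset.mem_insert,
      Finset.mem_singleton]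
    constructor
    · rintro ⟨hyS, hdom⟩
      obtain ⟨k, hkmin⟩ := hS y
      have hx : ∀ x : S, ∃ i, i ≠ k ∧ m i = x ∧ q i x ≤ q i y := by
        rintro ⟨x, hx⟩
        obtain ⟨i, hi⟩ := hdom x
        refine ⟨i, ?_, ?_, hi y (by simp)⟩
        · rintro rfl
          have := hq i (le_antisymm (hi y (by simp)) (hkmin x hx))
          exact hyS (this ▸ hx)
        · exact hq i (le_antisymm (hmin i x hx) (hi _ (by simp [hmS])))
      choose e he hme hle using hx
      have hinj : Function.Injective e := fun x x' h => Subtype.ext (by rw [← hme x, ← hme x', h])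
      have himg : Finset.univ.image e = Finset.univ.erase k := by
        apply Finset.eq_of_subset_of_card_le
        · intro i hi
          obtain ⟨x, -, rfl⟩ := Finset.mem_image.1 hi
          simp [he x]
        · rw [Finset.card_image_of_injective _ hinj, Finset.card_erase_of_mem (Finset.mem_univ _),
            Finset.card_univ, Finset.card_univ, Fintype.card_coe]
          omega
      have hall : ∀ i, i ≠ k → ∃ x : S, e x = i := by
        intro i hi
        have : i ∈ Finset.univ.image e := by rw [himg]; simp [hi]
        simpa using this
      have hyM : ∀ i, i ≠ k → q i (m i) < q i y := by
        intro i hi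
        obtain ⟨x, rfl⟩ := hall i hi
        rw [hme]
        exact lt_of_le_of_ne (hle x) fun h => hyS (hq _ h ▸ x.2)
      have hkk : k = k₁ ∨ k = k₂ := by
        by_contra! hcon
        obtain ⟨x, hx⟩ := hall k₁ hcon.1.symm
        obtain ⟨x', hx'⟩ := hall k₂ hcon.2.symm
        have hxx : x = x' := Subtype.ext (by rw [← hme x, ← hme x', hx, hx', hmk])
        exact hk (by rw [← hx, ← hx', hxx])
      have hyk : y = Y k := by
        refine hq k (le_antisymm (hYmax k y hyM) ?_)
        obtain ⟨i, hi⟩ := hdom (Y k)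
        by_cases hik : i = k
        · exact hik ▸ hi y (by simp)
        · exact absurd (hi _ (by simp [hmS])) (not_le.2 (hY k i hik))
      rcases hkk with rfl | rfl
      · exact Or.inl hyk
      · exact Or.inr hyk
    · intro hy
      obtain ⟨k, hkk, rfl⟩ : ∃ k, (k = k₁ ∨ k = k₂) ∧ y = Y k := by
        rcases hy with rfl | rfl
        · exact ⟨k₁, Or.inl rfl, rfl⟩
        · exact ⟨k₂, Or.inr rfl, rfl⟩
      refine ⟨hYS k hkk, fun z => ?_⟩
      by_cases hz : ∀ i, i ≠ k → q i (m i) < q i z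
      · refine ⟨k, fun x hx => (hYmax k z hz).trans ?_⟩
        rcases Finset.mem_insert.1 hx with rfl | hx
        · exact le_rfl
        · exact hYlt k x hx
      · push Not at hz
        obtain ⟨i, hik, hi⟩ := hz
        refine ⟨i, fun x hx => hi.trans ?_⟩
        rcases Finset.mem_insert.1 hx with rfl | hx
        · exact (hY k i hik).le
        · exact hmin i x hx
  rw [hset, Finset.card_pair]
  intro h
  have h1 := hY k₁ k₂ hk.symm
  rw [h] at h1
  exact absurd (hYlt k₂ _ (hmS k₂)) (not_le.2 h1)

open Classical in
/-- In a set with as many elements as there are colours, the elements whose removal leaves exactly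
the colours other than `i₀` come in pairs, unless all colours occur. -/
theorem even_card_erase {c : V → I} {S : Finset V} (hcard : S.card = Fintype.card I)
    (hc : S.image c ≠ Finset.univ) (i₀ : I) :
    Even (S.filter fun x => (S.erase x).image c = Finset.univ.erase i₀).card := by
  rcases (S.filter fun x => (S.erase x).image c = Finset.univ.erase i₀).eq_empty_or_nonempty
    with h | ⟨x, hx⟩
  · simp [h]
  have hinj : ∀ x ∈ S, (S.erase x).image c = Finset.univ.erase i₀ →
      Set.InjOn c (S.erase x : Finset V) := by
    intro x hx h
    rw [← Finset.card_image_iff, h, Finset.card_erase_of_mem hx,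
      Finset.card_erase_of_mem (Finset.mem_univ _), Finset.card_univ, hcard]
  obtain ⟨hxS, hxc⟩ := Finset.mem_filter.1 hx
  have hcx : c x ∈ (S.erase x).image c := by
    rw [hxc]
    refine Finset.mem_erase.2 ⟨fun h => hc ?_, Finset.mem_univ _⟩
    rw [← Finset.insert_erase hxS, Finset.image_insert, hxc, h,
      Finset.insert_erase (Finset.mem_univ _)]
  obtain ⟨x', hx', hcc⟩ := Finset.mem_image.1 hcx
  have hne : x' ≠ x := (Finset.mem_erase.1 hx').1
  have hx'S : x' ∈ S := (Finset.mem_erase.1 hx').2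
  have hset : (S.filter fun x => (S.erase x).image c = Finset.univ.erase i₀) = {x, x'} := by
    ext y
    simp only [Finset.mem_filter, Finset.mem_insert, Finset.mem_singleton]
    constructor
    · rintro ⟨hyS, hy⟩
      by_contra! hcon
      exact hne (hinj y hyS hy (by simp [hcon.2.symm, hx'S]) (by simp [hcon.1.symm, hxS]) hcc)
    · rintro (rfl | rfl)
      · exact ⟨hxS, hxc⟩
      · refine ⟨hx'S, ?_⟩
        rw [← hxc, ← Finset.insert_erase hx', ← Finset.insert_erase (s := S.erase y) (a := x)
          (by simp [hne.symm, hxS]), Finset.image_insert, Finset.image_insert, hcc,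
          Finset.erase_right_comm]
  rw [hset, Finset.card_pair hne.symm]
  exact even_two

open Classical in
/-- **Scarf's lemma.** The points `s i` are slack points: `s i` is ranked lowest by `q i` and above
all non-slack points by the other rankings. If `s i` has colour `i` for all `i`, then there is a
dominant set with as many elements as colours on which every colour occurs.

The proof is by parity. Call the dominant sets with as many elements as colours rooms, and those
with one element less on which exactly the colours other than a fixed `i₀` occur doors. Every door
lies in two rooms, except for the set of slack points of colour other than `i₀`, which lies in
one. Rooms on which not all colours occur contain an even number of doors. -/
theorem exists_dominant_colorful [Fintype V] {q : I → V → ℕ} (hq : ∀ i, Function.Injective (q i))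
    [Nonempty I] {s : I → V} (hlow : ∀ i x, q i (s i) ≤ q i x)
    (hhigh : ∀ i j, j ≠ i → ∀ x, (∀ k, x ≠ s k) → q i x < q i (s j))
    {c : V → I} (hc : ∀ i, c (s i) = i) :
    ∃ S : Finset V, IsDominant q S ∧ S.card = Fintype.card I ∧ S.image c = Finset.univ := by
  by_contra hcon
  push Not at hcon
  obtain ⟨i₀⟩ := ‹Nonempty I›
  have hs : Function.Injective s := fun i j h => by rw [← hc i, h, hc]
  have hlow' : ∀ i k, i ≠ k → q i (s i) < q i (s k) := fun i k hik =>
    lt_of_le_of_ne (hlow i _) fun h => hik (hs (hq i h))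
  set n := Fintype.card I with hn
  have hnpos : 0 < n := Fintype.card_pos_iff.2 ⟨i₀⟩
  set rooms : Finset (Finset V) := Finset.univ.filter fun S => IsDominant q S ∧ S.card = n
    with hrooms
  set doors : Finset (Finset V) := Finset.univ.filter fun S =>
    IsDominant q S ∧ S.card + 1 = n ∧ S.image c = Finset.univ.erase i₀ with hdoors
  set outer : Finset V := (Finset.univ.erase i₀).image s with houter
  have hcout : ∀ i, ((Finset.univ.erase i).image s).card + 1 = n := by
    intro i
    rw [Finset.card_image_of_injective _ hs, Finset.card_erase_of_mem (Finset.mem_univ _),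
      Finset.card_univ]
    omega
  have hcolout : ∀ i, ((Finset.univ.erase i).image s).image c = Finset.univ.erase i := by
    intro i
    rw [Finset.image_image]
    have : c ∘ s = id := funext hc
    rw [this, Finset.image_id]
  have hdouble := Finset.sum_card_bipartiteAbove_eq_sum_card_bipartiteBelow
    (s := doors) (t := rooms) (fun S' S => S' ⊆ S)
  -- Rooms above a door correspond to the points whose addition keeps the door dominant.
  have habove : ∀ S' ∈ doors, (rooms.bipartiteAbove (fun S' S => S' ⊆ S) S').card =
      (Finset.univ.filter fun y => y ∉ S' ∧ IsDominant q (insert y S')).card := by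
    intro S' hS'
    obtain ⟨-, hdom, hcard, -⟩ := Finset.mem_filter.1 hS'
    symm
    apply Finset.card_bij (fun y _ => insert y S')
    · intro y hy
      obtain ⟨-, hy, hyd⟩ := Finset.mem_filter.1 hy
      simp only [Finset.bipartiteAbove, hrooms, Finset.mem_filter, Finset.mem_univ, true_and]
      exact ⟨⟨hyd, by rw [Finset.card_insert_of_notMem hy, hcard]⟩, Finset.subset_insert _ _⟩
    · intro y hy y' hy' h
      obtain ⟨-, hy, -⟩ := Finset.mem_filter.1 hy
      have : y ∈ insert y' S' := h ▸ Finset.mem_insert_self _ _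
      exact (Finset.mem_insert.1 this).resolve_right hy
    · intro S hS
      simp only [Finset.bipartiteAbove, hrooms, Finset.mem_filter, Finset.mem_univ, true_and] at hS
      obtain ⟨⟨hSd, hSc⟩, hsub⟩ := hS
      have : (S \ S').card = 1 := by rw [Finset.card_sdiff_of_subset hsub]; omega
      obtain ⟨y, hy⟩ := Finset.card_eq_one.1 this
      have hyS : insert y S' = S := by
        rw [Finset.insert_eq, ← hy, Finset.sdiff_union_of_subset hsub]
      have hy' : y ∈ S \ S' := by rw [hy]; simp
      exact ⟨y, by simp [(Finset.mem_sdiff.1 hy').2, hyS, hSd], hyS⟩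
  have houterdoor : outer ∈ doors := by
    simp only [hdoors, Finset.mem_filter, Finset.mem_univ, true_and]
    refine ⟨fun y => ?_, hcout i₀, hcolout i₀⟩
    by_cases hy : ∃ k, y = s k
    · obtain ⟨k, rfl⟩ := hy
      exact ⟨k, fun x _ => hlow k x⟩
    · push Not at hy
      refine ⟨i₀, fun x hx => ?_⟩
      obtain ⟨j, hj, rfl⟩ := Finset.mem_image.1 hx
      exact (hhigh i₀ j (Finset.mem_erase.1 hj).1 y hy).le
  -- Exactly one room contains `outer`: it is obtained by adding the point ranked highest by `q i₀`
  -- among the remaining ones. Any other door fails to lie inside a set `(univ.erase i).image s`,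
  -- which makes the slack point `s k` available in `card_dominant_insert`.
  have hodd : Odd (∑ S' ∈ doors, (rooms.bipartiteAbove (fun S' S => S' ⊆ S) S').card) := by
    rw [← Finset.add_sum_erase _ _ houterdoor]
    refine Odd.add_even ?_ (Finset.even_sum _ fun S' hS' => ?_)
    · rw [habove _ houterdoor]
      obtain ⟨y, hy, hymax⟩ := (outerᶜ).exists_max_image (q i₀)
        ⟨s i₀, by simp [houter, hs.eq_iff]⟩
      have hy := Finset.mem_compl.1 hy
      have : (Finset.univ.filter fun y => y ∉ outer ∧ IsDominant q (insert y outer)) = {y} := by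
        ext y'
        simp only [Finset.mem_filter, Finset.mem_univ, true_and, Finset.mem_singleton]
        constructor
        · rintro ⟨hy', hd⟩
          refine hq i₀ (le_antisymm (hymax _ (Finset.mem_compl.2 hy')) ?_)
          obtain ⟨i, hi⟩ := hd y
          by_cases hii : i = i₀
          · exact hii ▸ hi y' (by simp)
          · have hmem : s i ∈ outer := by simp [houter, hs.eq_iff, hii]
            have := hq i (le_antisymm (hi (s i) (by simp [hmem])) (hlow i y))
            exact absurd (this ▸ hmem) hy
        · rintro rfl
          refine ⟨hy, fun z => ?_⟩
          by_cases hz : ∃ k, z = s k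
          · obtain ⟨k, rfl⟩ := hz
            exact ⟨k, fun x _ => hlow k x⟩
          · have hz' : z ∉ outer := fun h => by
              obtain ⟨k, -, hk⟩ := Finset.mem_image.1 h
              exact hz ⟨k, hk.symm⟩
            push Not at hz
            refine ⟨i₀, fun x hx => ?_⟩
            rcases Finset.mem_insert.1 hx with rfl | hx
            · exact hymax _ (Finset.mem_compl.2 hz')
            · obtain ⟨j, hj, rfl⟩ := Finset.mem_image.1 hx
              exact (hhigh i₀ j (Finset.mem_erase.1 hj).1 z hz).le
      rw [this]
      simp
    · obtain ⟨hneq, hmem⟩ := Finset.mem_erase.1 hS'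
      rw [habove _ hmem]
      obtain ⟨-, hdom, hcard, hcol⟩ := Finset.mem_filter.1 hmem
      rw [card_dominant_insert hq hdom hcard]
      · exact even_two
      · by_contra hemp
        rw [Finset.not_nonempty_iff_eq_empty] at hemp
        have h0 := hcout i₀
        rw [← hcard, hemp, Finset.card_empty, add_left_inj, Finset.card_eq_zero] at h0
        exact hneq (hemp.trans h0.symm)
      · refine fun k => ⟨s k, fun i hik => ?_⟩
        by_contra! hall
        apply hneq
        have hsub : S' ⊆ (Finset.univ.erase i).image s := by
          intro x hx
          by_cases hxs : ∃ j, x = s j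
          · obtain ⟨j, rfl⟩ := hxs
            refine Finset.mem_image_of_mem _ (Finset.mem_erase.2 ⟨?_, Finset.mem_univ _⟩)
            rintro rfl
            exact absurd (hall _ hx) (not_le.2 (hlow' _ k hik))
          · push Not at hxs
            exact absurd (hall _ hx) (not_le.2 (hhigh i k hik.symm x hxs))
        have heq := Finset.eq_of_subset_of_card_le hsub (by have := hcout i; omega)
        have hii : i = i₀ := by
          have h1 := hcolout i
          rw [← heq, hcol] at h1
          by_contra hne
          have : i ∈ Finset.univ.erase i₀ := by simp [hne]
          rw [h1] at this
          simp at this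
        rw [heq, hii]
  have heven : Even (∑ S ∈ rooms, (doors.bipartiteBelow (fun S' S => S' ⊆ S) S).card) := by
    refine Finset.even_sum _ fun S hS => ?_
    obtain ⟨-, hdom, hcard⟩ := Finset.mem_filter.1 hS
    have : (doors.bipartiteBelow (fun S' S => S' ⊆ S) S).card =
        (S.filter fun x => (S.erase x).image c = Finset.univ.erase i₀).card := by
      symm
      apply Finset.card_bij (fun x _ => S.erase x)
      · intro x hx
        obtain ⟨hx, hxc⟩ := Finset.mem_filter.1 hx
        simp only [Finset.bipartiteBelow, hdoors, Finset.mem_filter, Finset.mem_univ, true_and]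
        exact ⟨⟨hdom.mono (Finset.erase_subset _ _),
          by rw [Finset.card_erase_add_one hx, hcard], hxc⟩, Finset.erase_subset _ _⟩
      · intro x hx y hy h
        exact Finset.erase_injOn S (Finset.mem_filter.1 hx).1 (Finset.mem_filter.1 hy).1 h
      · intro S' hS'
        simp only [Finset.bipartiteBelow, hdoors, Finset.mem_filter, Finset.mem_univ,
          true_and] at hS'
        obtain ⟨⟨-, hc1, hc2⟩, hsub⟩ := hS'
        have : (S \ S').card = 1 := by rw [Finset.card_sdiff_of_subset hsub]; omega
        obtain ⟨y, hy⟩ := Finset.card_eq_one.1 this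
        have hy' : y ∈ S \ S' := by rw [hy]; simp
        have hyS : S.erase y = S' := by
          rw [Finset.erase_eq, ← hy, Finset.sdiff_sdiff_eq_self hsub]
        exact ⟨y, by simp [(Finset.mem_sdiff.1 hy').1, hyS, hc2], hyS⟩
    rw [this]
    exact even_card_erase hcard (hcon S hdom hcard) i₀
  rw [hdouble] at hodd
  exact Nat.not_odd_iff_even.2 heven hodd

end Scarf

/-! ### Brouwer's fixed point theorem on the simplex -/

section Brouwer

variable {ι : Type*} [Fintype ι] [Nonempty ι]

open Classical in
/-- Discrete form of Brouwer's theorem on the grid of points of `ℕ^ι` with coordinate sum `N`: for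
every colouring there is a grid point near which each colour occurs, apart from the colours for
which the coordinate of the point is small. -/
theorem exists_grid_point_near_colors (N : ℕ) (c : (ι → ℕ) → ι) :
    ∃ z : ι → ℕ, ∑ i, z i = N ∧ ∀ i, (∃ x : ι → ℕ, ∑ i, x i = N ∧ c x = i ∧
      ∀ j, x j ≤ z j + Fintype.card ι ∧ z j ≤ x j + Fintype.card ι) ∨ z i ≤ Fintype.card ι := by
  set P : Finset (ι → ℕ) := Finset.univ.piAntidiag N with hP
  have hmemP : ∀ x, x ∈ P ↔ ∑ i, x i = N := by simp [hP]
  set M := Fintype.card P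
  let idx : P ≃ Fin M := Fintype.equivFin P
  let idI : ι ≃ Fin (Fintype.card ι) := Fintype.equivFin ι
  -- The `i`-th ranking compares `i`-th coordinates, with ties broken by an enumeration.
  let q : ι → P ⊕ ι → ℕ := fun i v => match v with
    | .inl x => 1 + (M * x.1 i + idx x)
    | .inr j => if j = i then 0 else 1 + (M * (N + 1) + idI j)
  have hlt : ∀ (i : ι) (x y : P), x.1 i < y.1 i → M * x.1 i + idx x < M * y.1 i + idx y := by
    intro i x y h
    have h1 : M * (x.1 i + 1) ≤ M * y.1 i := Nat.mul_le_mul_left _ h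
    have h2 := (idx x).2
    rw [mul_add] at h1
    omega
  have hhigh' : ∀ (i : ι) (x : P), M * x.1 i + idx x < M * (N + 1) := by
    intro i x
    have h0 : x.1 i ≤ N := by
      have := (hmemP _).1 x.2
      rw [← this]
      exact Finset.single_le_sum (f := x.1) (fun _ _ => Nat.zero_le _) (Finset.mem_univ i)
    have h1 : M * (x.1 i + 1) ≤ M * (N + 1) := Nat.mul_le_mul_left _ (by omega)
    have h2 := (idx x).2
    rw [mul_add] at h1
    omega
  have hq : ∀ i, Function.Injective (q i) := by
    rintro i (x | j) (y | k) h
    · simp only [q] at h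
      rcases lt_trichotomy (x.1 i) (y.1 i) with h' | h' | h'
      · have := hlt i x y h'; omega
      · rw [h'] at h
        congr 1
        apply idx.injective
        ext
        omega
      · have := hlt i y x h'; omega
    · simp only [q] at h
      have := hhigh' i x
      split_ifs at h <;> omega
    · simp only [q] at h
      have := hhigh' i y
      split_ifs at h <;> omega
    · simp only [q] at h
      split_ifs at h with h1 h2 h2
      · rw [h1, h2]
      · omega
      · omega
      · congr 1
        apply idI.injective
        ext
        omega
  obtain ⟨S, hdom, -, hcol⟩ := Scarf.exists_dominant_colorful (q := q) hq (s := Sum.inr)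
    (c := Sum.elim (fun x => c x.1) id) (by intro i x; simp [q])
    (by
      rintro i j hji (x | k) hx
      · have := hhigh' i x
        simp only [q, if_neg hji]
        omega
      · exact absurd rfl (hx k)) (fun i => rfl)
  have hdom' : ∀ y : ι → ℕ, ∑ i, y i = N →
      ∃ i, Sum.inr i ∉ S ∧ ∀ x : P, Sum.inl x ∈ S → y i ≤ x.1 i := by
    intro y hy
    obtain ⟨i, hi⟩ := hdom (Sum.inl ⟨y, (hmemP y).2 hy⟩)
    refine ⟨i, fun hmem => ?_, fun x hx => ?_⟩
    · have := hi _ hmem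
      simp [q] at this
    · by_contra! hcon
      have h1 := hi _ hx
      have h2 : M * x.1 i + idx x < M * y i + idx ⟨y, (hmemP y).2 hy⟩ :=
        hlt i x ⟨y, (hmemP y).2 hy⟩ hcon
      simp only [q] at h1
      omega
  have hcol' : ∀ i, Sum.inr i ∉ S → ∃ x : P, Sum.inl x ∈ S ∧ c x.1 = i := by
    intro i hi
    have : i ∈ S.image (Sum.elim (fun x : P => c x.1) id) := by rw [hcol]; simp
    obtain ⟨x | j, hx, hxi⟩ := Finset.mem_image.1 this
    · exact ⟨x, hx, hxi⟩
    · simp only [Sum.elim_inr, id] at hxi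
      exact absurd (hxi ▸ hx) hi
  set C : Finset ι := Finset.univ.filter fun i => Sum.inr i ∉ S with hC
  have hmemC : ∀ i, i ∈ C ↔ Sum.inr i ∉ S := by simp [hC]
  obtain ⟨i₀⟩ := ‹Nonempty ι›
  obtain ⟨i₁, hi₁, -⟩ := hdom' (Pi.single i₀ N) (by simp)
  obtain ⟨z, hzS, -⟩ := hcol' i₁ hi₁
  have hmin : ∀ i, ∃ m, (∀ x : P, Sum.inl x ∈ S → m ≤ x.1 i) ∧
      ∃ x : P, Sum.inl x ∈ S ∧ x.1 i = m := by
    intro i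
    obtain ⟨x, hx, hx'⟩ := (Finset.univ.filter fun x : P => Sum.inl x ∈ S).exists_min_image
      (fun x => x.1 i) ⟨z, by simp [hzS]⟩
    exact ⟨x.1 i, fun y hy => hx' y (by simp [hy]), x, by simpa using hx, rfl⟩
  choose m hm hm' using hmin
  -- Otherwise a grid point exceeding the minimum of `S` in all coordinates of `C` would exist.
  have hsum : N < ∑ i ∈ C, (m i + 1) := by
    by_contra! hcon
    obtain ⟨r, hr⟩ := Nat.exists_eq_add_of_le hcon
    obtain ⟨i, hi, hi'⟩ := hdom' (fun i => (if i ∈ C then m i + 1 else 0) + if i = i₁ then r else 0)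
      (by rw [Finset.sum_add_distrib, hr]; simp)
    obtain ⟨x, hx, hxi⟩ := hm' i
    have := hi' x hx
    rw [if_pos ((hmemC i).2 hi), hxi] at this
    omega
  have hcardC : C.card ≤ Fintype.card ι := Finset.card_le_univ C
  rw [Finset.sum_add_distrib, Finset.sum_const, smul_eq_mul, mul_one] at hsum
  have hin : ∀ x : P, Sum.inl x ∈ S → ∀ j ∈ C, x.1 j ≤ m j + Fintype.card ι := by
    intro x hx j hj
    have h1 : ∑ i ∈ C, x.1 i ≤ N := by
      rw [← (hmemP _).1 x.2]
      exact Finset.sum_le_sum_of_subset (Finset.subset_univ _)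
    rw [← Finset.add_sum_erase _ _ hj] at h1 hsum
    have h2 : ∑ i ∈ C.erase j, m i ≤ ∑ i ∈ C.erase j, x.1 i :=
      Finset.sum_le_sum fun i _ => hm i x hx
    omega
  have hout : ∀ x : P, Sum.inl x ∈ S → ∀ j ∉ C, x.1 j ≤ Fintype.card ι := by
    intro x hx j hj
    have h1 : ∑ i ∈ insert j C, x.1 i ≤ N := by
      rw [← (hmemP _).1 x.2]
      exact Finset.sum_le_sum_of_subset (Finset.subset_univ _)
    rw [Finset.sum_insert hj] at h1
    have h2 : ∑ i ∈ C, m i ≤ ∑ i ∈ C, x.1 i := Finset.sum_le_sum fun i _ => hm i x hx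
    omega
  refine ⟨z.1, (hmemP _).1 z.2, fun i => ?_⟩
  by_cases hi : i ∈ C
  · left
    obtain ⟨x, hx, hxi⟩ := hcol' i ((hmemC i).1 hi)
    refine ⟨x.1, (hmemP _).1 x.2, hxi, fun j => ?_⟩
    by_cases hj : j ∈ C
    · have h1 := hin x hx j hj
      have h2 := hin z hzS j hj
      have h3 := hm j x hx
      have h4 := hm j z hzS
      omega
    · have h1 := hout x hx j hj
      have h2 := hout z hzS j hj
      omega
  · exact Or.inr (hout z hzS i hi)

/-- **Brouwer's fixed point theorem** for the standard simplex. -/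
theorem exists_fixedPoint_stdSimplex {f : (ι → ℝ) → ι → ℝ} (hf : ContinuousOn f (stdSimplex ℝ ι))
    (hmaps : Set.MapsTo f (stdSimplex ℝ ι) (stdSimplex ℝ ι)) :
    ∃ x ∈ stdSimplex ℝ ι, f x = x := by
  classical
  set n : ℝ := (Fintype.card ι : ℝ) with hn
  have hcolor : ∀ x ∈ stdSimplex ℝ ι, ∃ i, x i ≤ f x i := by
    intro x hx
    by_contra! hcon
    have := Finset.sum_lt_sum_of_nonempty (Finset.univ_nonempty (α := ι)) fun i _ => hcon i
    rw [hx.2, (hmaps hx).2] at this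
    exact lt_irrefl _ this
  have hgrid : ∀ k : ℕ, ∃ z ∈ stdSimplex ℝ ι, ∀ i, (∃ x ∈ stdSimplex ℝ ι, x i ≤ f x i ∧
      dist x z ≤ n / (k + 1)) ∨ z i ≤ n / (k + 1) := by
    intro k
    have hk : (0 : ℝ) < k + 1 := by positivity
    let emb : (ι → ℕ) → ι → ℝ := fun x i => x i / (k + 1 : ℝ)
    have hemb : ∀ x : ι → ℕ, ∑ i, x i = k + 1 → emb x ∈ stdSimplex ℝ ι := by
      intro x hx
      refine ⟨fun i => by positivity, ?_⟩
      rw [← Finset.sum_div, div_eq_one_iff_eq hk.ne']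
      exact_mod_cast hx
    have hc : ∀ x : ι → ℕ, ∃ i, ∑ i, x i = k + 1 → emb x i ≤ f (emb x) i := by
      intro x
      by_cases hx : ∑ i, x i = k + 1
      · obtain ⟨i, hi⟩ := hcolor _ (hemb x hx)
        exact ⟨i, fun _ => hi⟩
      · exact ⟨Classical.arbitrary ι, fun h => absurd h hx⟩
    choose c hc using hc
    obtain ⟨z, hz, hz'⟩ := exists_grid_point_near_colors (k + 1) c
    refine ⟨emb z, hemb z hz, fun i => ?_⟩
    rcases hz' i with ⟨x, hx, rfl, hxz⟩ | h
    · refine Or.inl ⟨emb x, hemb x hx, hc x hx, ?_⟩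
      rw [dist_pi_le_iff (by positivity)]
      intro j
      have h1 : (x j : ℝ) ≤ z j + n := by rw [hn]; exact_mod_cast (hxz j).1
      have h2 : (z j : ℝ) ≤ x j + n := by rw [hn]; exact_mod_cast (hxz j).2
      rw [Real.dist_eq, ← sub_div, abs_div, abs_of_pos hk]
      gcongr
      rw [abs_le]
      constructor <;> linarith
    · right
      have : (z i : ℝ) ≤ n := by rw [hn]; exact_mod_cast h
      simp only [emb]
      gcongr
  choose z hz hz' using hgrid
  obtain ⟨y, hy, φ, hφ, hlim⟩ := (isCompact_stdSimplex ℝ ι).tendsto_subseq hz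
  have hsmall : Tendsto (fun k : ℕ => n / ((φ k : ℕ) + 1 : ℝ)) atTop (nhds 0) := by
    have h : Tendsto (fun k : ℕ => n * (1 / ((k : ℝ) + 1))) atTop (nhds (n * 0)) :=
      tendsto_one_div_add_atTop_nhds_zero_nat.const_mul n
    simp only [mul_zero, mul_one_div] at h
    exact h.comp hφ.tendsto_atTop
  have hle : ∀ i, y i ≤ f y i := by
    intro i
    by_contra! hlt
    have hypos : 0 < y i := ((hmaps hy).1 i).trans_lt hlt
    have hcont : ContinuousWithinAt (fun x => x i - f x i) (stdSimplex ℝ ι) y :=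
      ((continuous_apply i).continuousWithinAt).sub
        ((continuous_apply i).continuousAt.comp_continuousWithinAt (hf y hy))
    have hev := hcont.eventually (lt_mem_nhds (sub_pos.2 hlt))
    obtain ⟨r, hr, hball⟩ := Metric.mem_nhdsWithin_iff.1 hev
    have hcoord : Tendsto (fun k => z (φ k) i) atTop (nhds (y i)) :=
      ((continuous_apply i).tendsto y).comp hlim
    have e1 := hsmall.eventually (gt_mem_nhds (half_pos hr))
    have e2 := hlim.eventually (Metric.ball_mem_nhds y (half_pos hr))
    have e3 := hcoord.eventually (lt_mem_nhds (half_lt_self hypos))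
    have e4 := hsmall.eventually (gt_mem_nhds (half_pos hypos))
    obtain ⟨k, h1, h2, h3, h4⟩ := (e1.and (e2.and (e3.and e4))).exists
    rcases hz' (φ k) i with ⟨x, hx, hxi, hxz⟩ | h
    · have hxy : dist x y < r := by
        have := dist_triangle x (z (φ k)) y
        have h2' : dist (z (φ k)) y < r / 2 := h2
        linarith
      have : 0 < x i - f x i := hball ⟨hxy, hx⟩
      linarith
    · linarith
  refine ⟨y, hy, funext fun i => ?_⟩
  have := (Finset.sum_eq_sum_iff_of_le fun i _ => hle i).1 (hy.2.trans (hmaps hy).2.symm)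
  exact (this i (Finset.mem_univ i)).symm

/-- Variational inequality on the simplex: a continuous vector field `v` lies in the normal cone of
the simplex at some point `y`. The proof applies Brouwer's theorem to the map which moves `x`
towards the vertices `i` with `v x i` above the mean of `v x` under `x`. -/
theorem exists_variational_stdSimplex {v : (ι → ℝ) → ι → ℝ}
    (hv : ContinuousOn v (stdSimplex ℝ ι)) :
    ∃ y ∈ stdSimplex ℝ ι, ∀ i, v y i ≤ ∑ j, y j * v y j := by
  let φ : (ι → ℝ) → ι → ℝ := fun x i => max 0 (v x i - ∑ j, x j * v x j)
  have hφ0 : ∀ x i, 0 ≤ φ x i := fun x i => le_max_left _ _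
  have hS : ∀ x, 0 < 1 + ∑ j, φ x j := fun x =>
    add_pos_of_pos_of_nonneg one_pos (Finset.sum_nonneg fun j _ => hφ0 x j)
  have hvi : ∀ i, ContinuousOn (fun x => v x i) (stdSimplex ℝ ι) := fun i =>
    (continuous_apply i).comp_continuousOn hv
  have hφc : ∀ i, ContinuousOn (fun x => φ x i) (stdSimplex ℝ ι) := fun i =>
    continuousOn_const.sup ((hvi i).sub (continuousOn_finsetSum _ fun j _ =>
      (continuous_apply j).continuousOn.mul (hvi j)))
  obtain ⟨y, hy, hfix⟩ := exists_fixedPoint_stdSimplex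
    (f := fun x i => (x i + φ x i) / (1 + ∑ j, φ x j))
    (continuousOn_pi.2 fun i => ((continuous_apply i).continuousOn.add (hφc i)).div
      (continuousOn_const.add (continuousOn_finsetSum _ fun j _ => hφc j)) fun x _ => (hS x).ne')
    (fun x hx => ⟨fun i => div_nonneg (add_nonneg (hx.1 i) (hφ0 x i)) (hS x).le, by
      rw [← Finset.sum_div, Finset.sum_add_distrib, hx.2, div_self (hS x).ne']⟩)
  refine ⟨y, hy, ?_⟩
  have hfix' : ∀ i, φ y i = y i * ∑ j, φ y j := by
    intro i
    have := congrFun hfix i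
    rw [div_eq_iff (hS y).ne'] at this
    linarith
  -- The mean of `v y` is not below all the values which enter it with positive weight.
  obtain ⟨i, hi, hφi⟩ : ∃ i, 0 < y i ∧ φ y i = 0 := by
    by_contra! hcon
    have hpos : ∀ i, 0 < y i → 0 < v y i - ∑ j, y j * v y j := by
      intro i hi
      by_contra! hle
      exact hcon i hi (max_eq_left hle)
    have hsum : ∑ i, y i * (v y i - ∑ j, y j * v y j) = 0 := by
      simp only [mul_sub, Finset.sum_sub_distrib, ← Finset.sum_mul, hy.2, one_mul, sub_self]
    have hnn : ∀ i ∈ Finset.univ, 0 ≤ y i * (v y i - ∑ j, y j * v y j) := by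
      intro i _
      rcases (hy.1 i).eq_or_lt with h | h
      · simp [← h]
      · exact (mul_pos h (hpos i h)).le
    have hz := (Finset.sum_eq_zero_iff_of_nonneg hnn).1 hsum
    have hy0 : ∀ i, y i = 0 := by
      intro i
      by_contra hne
      have h := lt_of_le_of_ne (hy.1 i) (Ne.symm hne)
      exact (mul_pos h (hpos i h)).ne' (hz i (Finset.mem_univ i))
    have := hy.2
    simp [hy0] at this
  have hzero : ∑ j, φ y j = 0 := by
    have := hfix' i
    rw [hφi] at this
    exact (mul_eq_zero.1 this.symm).resolve_left hi.ne'
  intro i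
  have h := hfix' i
  rw [hzero, mul_zero] at h
  have := le_max_right 0 (v y i - ∑ j, y j * v y j)
  change _ ≤ φ y i at this
  linarith

end Brouwer

/-! ### The outgoing fixed point -/

namespace Forecast

variable {A : Type*} [Fintype A] [Nonempty A]

/-- Approximate form of `exists_outgoing_weights`, in coordinates: the weights are a continuous
partition of unity, each supported in a ball of radius `δ + ε` around a grid point. -/
theorem exists_outgoing_weights_approx {δ ε : ℝ} (hε : 0 < ε) {D : Finset (Simplex A)}
    (hgrid : IsGrid δ D) (g : Simplex A → Simplex A) :
    ∃ y ∈ stdSimplex ℝ A, ∃ w ∈ stdSimplex ℝ D,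
      (∀ c : D, w c * (dist (WithLp.toLp 2 y) c.1.1 - δ) ≤ ε) ∧
      ∀ i, ∑ c : D, w c * ((g c).1 i - c.1.1 i) ≤
        ∑ j, y j * ∑ c : D, w c * ((g c).1 j - c.1.1 j) := by
  let ρ : (A → ℝ) → D → ℝ := fun y c => max 0 (δ + ε - dist (WithLp.toLp 2 y) c.1.1)
  have hρ0 : ∀ y c, 0 ≤ ρ y c := fun y c => le_max_left _ _
  have hρc : ∀ c, Continuous fun y => ρ y c := by
    intro c
    have : Continuous fun y : A → ℝ => (WithLp.toLp 2 y : EuclideanSpace ℝ A) :=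
      PiLp.continuous_toLp 2 _
    fun_prop
  have hS : ∀ y ∈ stdSimplex ℝ A, 0 < ∑ c, ρ y c := by
    intro y hy
    obtain ⟨d, hd, hdist⟩ := hgrid ⟨WithLp.toLp 2 y, hy⟩
    refine Finset.sum_pos' (fun c _ => hρ0 y c) ⟨⟨d, hd⟩, Finset.mem_univ _, ?_⟩
    refine lt_max_of_lt_right ?_
    rw [Subtype.dist_eq] at hdist
    linarith
  let W : (A → ℝ) → D → ℝ := fun y c => ρ y c / ∑ c', ρ y c'
  have hWc : ∀ c, ContinuousOn (fun y => W y c) (stdSimplex ℝ A) := fun c =>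
    (hρc c).continuousOn.div (continuous_finsetSum _ fun c _ => hρc c).continuousOn
      fun y hy => (hS y hy).ne'
  have hW : ∀ y ∈ stdSimplex ℝ A, W y ∈ stdSimplex ℝ D := fun y hy =>
    ⟨fun c => div_nonneg (hρ0 y c) (hS y hy).le, by
      rw [← Finset.sum_div, div_self (hS y hy).ne']⟩
  obtain ⟨y, hy, hvar⟩ := exists_variational_stdSimplex
    (v := fun y i => ∑ c : D, W y c * ((g c).1 i - c.1.1 i))
    (continuousOn_pi.2 fun i => continuousOn_finsetSum _ fun c _ =>
      (hWc c).mul continuousOn_const)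
  refine ⟨y, hy, W y, hW y hy, fun c => ?_, hvar⟩
  have hw0 := (hW y hy).1 c
  have hw1 : W y c ≤ 1 := (mem_Icc_of_mem_stdSimplex (hW y hy) c).2
  by_cases hd : dist (WithLp.toLp 2 y) c.1.1 ≤ δ + ε
  · calc W y c * (dist (WithLp.toLp 2 y) c.1.1 - δ) ≤ W y c * ε :=
          mul_le_mul_of_nonneg_left (by linarith) hw0
      _ ≤ ε := mul_le_of_le_one_left hε.le hw1
  · have : ρ y c = 0 := max_eq_left (by linarith)
    simp only [W, this, zero_div, zero_mul, hε.le]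

/-- For every map `g` from the grid to the simplex there is a probability distribution on the
grid points of some ball of radius `δ` under which, whatever the action, a grid point `c` has on
average at most `δ ^ 2` more squared error than `g c`. The centre `y` of the ball is chosen such
that the mean of `g c - c` is in the normal cone of the simplex at `y`. -/
theorem exists_outgoing_weights {δ : ℝ} {D : Finset (Simplex A)}
    (hgrid : IsGrid δ D) (g : Simplex A → Simplex A) :
    ∃ y : Simplex A, ∃ w : Simplex A → ℝ, (∀ c, 0 ≤ w c) ∧ (∀ c ∉ D, w c = 0) ∧
      ∑ c ∈ D, w c = 1 ∧ (∀ c, w c ≠ 0 → dist c y ≤ δ) ∧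
      ∀ a : Simplex A, ∑ c ∈ D, w c * (‖a.1 - c.1‖ ^ 2 - ‖a.1 - (g c).1‖ ^ 2) ≤ δ ^ 2 := by
  classical
  have happrox := fun k : ℕ => exists_outgoing_weights_approx (δ := δ)
    (ε := 1 / ((k : ℝ) + 1)) (by positivity) hgrid g
  choose y hy w hw hdist hvar using happrox
  obtain ⟨⟨y', w'⟩, ⟨hy', hw'⟩, φ, hφ, hlim⟩ :=
    ((isCompact_stdSimplex ℝ A).prod (isCompact_stdSimplex ℝ D)).tendsto_subseq
      (x := fun k => (y k, w k)) fun k => ⟨hy k, hw k⟩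
  have hε : Tendsto (fun k => 1 / ((φ k : ℝ) + 1)) atTop (nhds 0) :=
    tendsto_one_div_add_atTop_nhds_zero_nat.comp hφ.tendsto_atTop
  have hdist' : ∀ c : D, w' c * (dist (WithLp.toLp 2 y') c.1.1 - δ) ≤ 0 := by
    intro c
    have hcont : Continuous fun p : (A → ℝ) × (D → ℝ) =>
        p.2 c * (dist (WithLp.toLp 2 p.1 : EuclideanSpace ℝ A) c.1.1 - δ) := by
      have : Continuous fun y : A → ℝ => (WithLp.toLp 2 y : EuclideanSpace ℝ A) :=
        PiLp.continuous_toLp 2 _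
      fun_prop
    exact le_of_tendsto_of_tendsto' ((hcont.tendsto _).comp hlim) hε fun k => hdist (φ k) c
  have hvar' : ∀ i, ∑ c : D, w' c * ((g c).1 i - c.1.1 i) ≤
      ∑ j, y' j * ∑ c : D, w' c * ((g c).1 j - c.1.1 j) := by
    intro i
    have h1 : Continuous fun p : (A → ℝ) × (D → ℝ) =>
        ∑ c : D, p.2 c * ((g c).1 i - c.1.1 i) := by fun_prop
    have h2 : Continuous fun p : (A → ℝ) × (D → ℝ) =>
        ∑ j, p.1 j * ∑ c : D, p.2 c * ((g c).1 j - c.1.1 j) := by fun_prop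
    exact le_of_tendsto_of_tendsto' ((h1.tendsto _).comp hlim) ((h2.tendsto _).comp hlim)
      fun k => hvar (φ k) i
  have hball : ∀ c : D, w' c ≠ 0 → dist (WithLp.toLp 2 y') c.1.1 ≤ δ := by
    intro c hc
    have hpos : 0 < w' c := lt_of_le_of_ne (hw'.1 c) (Ne.symm hc)
    by_contra! hcon
    exact absurd (hdist' c) (not_le.2 (mul_pos hpos (sub_pos.2 hcon)))
  have hsumD : ∀ F : Simplex A → ℝ, ∑ c ∈ D, (if h : c ∈ D then w' ⟨c, h⟩ else 0) * F c =
      ∑ c : D, w' c * F c := by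
    intro F
    rw [← Finset.sum_coe_sort D]
    exact Finset.sum_congr rfl fun c _ => by rw [dif_pos c.2]
  refine ⟨⟨WithLp.toLp 2 y', hy'⟩, fun c => if h : c ∈ D then w' ⟨c, h⟩ else 0,
    fun c => ?_, fun c hc => dif_neg hc, ?_, fun c hc => ?_, fun a => ?_⟩
  · dsimp only
    split_ifs with h
    · exact hw'.1 _
    · exact le_rfl
  · have := hsumD fun _ => 1
    simp only [mul_one] at this
    rw [this, hw'.2]
  · dsimp only at hc
    split_ifs at hc with h
    · rw [Subtype.dist_eq, dist_comm]
      exact hball ⟨c, h⟩ hc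
    · exact absurd rfl hc
  · rw [hsumD]
    set Y : EuclideanSpace ℝ A := WithLp.toLp 2 y' with hY
    have hexp : ∀ c : D, ‖a.1 - c.1.1‖ ^ 2 - ‖a.1 - (g c).1‖ ^ 2 ≤
        ‖Y - c.1.1‖ ^ 2 + 2 * ∑ i, (a.1 i - y' i) * ((g c).1 i - c.1.1 i) := by
      intro c
      have h1 : 0 ≤ ‖Y - (g c).1‖ ^ 2 := by positivity
      have h2 : ‖a.1 - c.1.1‖ ^ 2 - ‖a.1 - (g c).1‖ ^ 2 = ‖Y - c.1.1‖ ^ 2 - ‖Y - (g c).1‖ ^ 2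
          + 2 * ∑ i, (a.1 i - y' i) * ((g c).1 i - c.1.1 i) := by
        simp only [EuclideanSpace.real_norm_sq_eq, PiLp.sub_apply, hY, Finset.mul_sum,
          ← Finset.sum_sub_distrib, ← Finset.sum_add_distrib]
        exact Finset.sum_congr rfl fun i _ => by ring
      linarith
    have hsq : ∀ c : D, w' c * ‖Y - c.1.1‖ ^ 2 ≤ w' c * δ ^ 2 := by
      intro c
      by_cases hc : w' c = 0
      · simp [hc]
      · have := hball c hc
        rw [dist_eq_norm] at this
        have h0 := hw'.1 c
        gcongr
    have hswap : ∑ c : D, w' c * ∑ i, (a.1 i - y' i) * ((g c).1 i - c.1.1 i) ≤ 0 := by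
      have heq : ∑ c : D, w' c * ∑ i, (a.1 i - y' i) * ((g c).1 i - c.1.1 i) =
          ∑ i, a.1 i * (∑ c : D, w' c * ((g c).1 i - c.1.1 i)) -
          ∑ i, y' i * (∑ c : D, w' c * ((g c).1 i - c.1.1 i)) := by
        simp only [Finset.mul_sum, ← Finset.sum_sub_distrib]
        rw [Finset.sum_comm]
        refine Finset.sum_congr rfl fun i _ => Finset.sum_congr rfl fun c _ => by ring
      rw [heq, sub_nonpos]
      calc ∑ i, a.1 i * (∑ c : D, w' c * ((g c).1 i - c.1.1 i))
          ≤ ∑ i, a.1 i * ∑ j, y' j * ∑ c : D, w' c * ((g c).1 j - c.1.1 j) :=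
            Finset.sum_le_sum fun i _ => mul_le_mul_of_nonneg_left (hvar' i) (a.2.1 i)
        _ = _ := by rw [← Finset.sum_mul, a.2.2, one_mul]
    calc ∑ c : D, w' c * (‖a.1 - c.1.1‖ ^ 2 - ‖a.1 - (g c).1‖ ^ 2)
        ≤ ∑ c : D, (w' c * δ ^ 2 + 2 * (w' c * ∑ i, (a.1 i - y' i) * ((g c).1 i - c.1.1 i))) := by
          refine Finset.sum_le_sum fun c _ => ?_
          have := mul_le_mul_of_nonneg_left (hexp c) (hw'.1 c)
          have := hsq c
          linarith
      _ ≤ δ ^ 2 := by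
          rw [Finset.sum_add_distrib, ← Finset.sum_mul, ← Finset.mul_sum, hw'.2]
          linarith

end Forecast

/-! ### Expectations over finitely supported distributions -/

namespace Forecast

section Mean

variable {X Y : Type*}

/-- The mean of `F` under the discrete distribution `p`. -/
noncomputable def pmfMean (p : PMF X) (F : X → ℝ) : ℝ := ∑' x, (p x).toReal * F x

variable {p : PMF X} {S : Finset X}

theorem pmfMean_eq_sum (hp : p.support ⊆ S) (F : X → ℝ) :
    pmfMean p F = ∑ x ∈ S, (p x).toReal * F x := by
  refine tsum_eq_sum fun x hx => ?_
  have : p x = 0 := by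
    by_contra h
    exact hx (hp ((PMF.mem_support_iff p x).2 h))
  simp [this]

theorem sum_toReal_eq_one (hp : p.support ⊆ S) : ∑ x ∈ S, (p x).toReal = 1 := by
  rw [← ENNReal.toReal_sum fun x _ => p.apply_ne_top x]
  have : ∑ x ∈ S, p x = 1 := by
    rw [← p.tsum_coe]
    refine (tsum_eq_sum fun x hx => ?_).symm
    by_contra h
    exact hx (hp ((PMF.mem_support_iff p x).2 h))
  simp [this]

theorem pmfMean_mono (hp : p.support ⊆ S) {F G : X → ℝ} (h : ∀ x ∈ S, F x ≤ G x) :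
    pmfMean p F ≤ pmfMean p G := by
  rw [pmfMean_eq_sum hp, pmfMean_eq_sum hp]
  exact Finset.sum_le_sum fun x hx => mul_le_mul_of_nonneg_left (h x hx) ENNReal.toReal_nonneg

theorem pmfMean_add_const (hp : p.support ⊆ S) (F : X → ℝ) (r : ℝ) :
    pmfMean p (fun x => F x + r) = pmfMean p F + r := by
  simp only [pmfMean_eq_sum hp, mul_add, Finset.sum_add_distrib, ← Finset.sum_mul,
    sum_toReal_eq_one hp, one_mul]

theorem pmfMean_const_mul (p : PMF X) (F : X → ℝ) (r : ℝ) :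
    pmfMean p (fun x => r * F x) = r * pmfMean p F := by
  simp only [pmfMean, ← tsum_mul_left]
  exact tsum_congr fun x => by ring

/-- Jensen's inequality for the square root. -/
theorem pmfMean_sqrt_le (hp : p.support ⊆ S) {F : X → ℝ} (hF : ∀ x, 0 ≤ F x) :
    pmfMean p (fun x => Real.sqrt (F x)) ≤ Real.sqrt (pmfMean p F) := by
  set μ := pmfMean p (fun x => Real.sqrt (F x)) with hμ
  refine Real.le_sqrt_of_sq_le ?_
  have h0 : 0 ≤ ∑ x ∈ S, (p x).toReal * (Real.sqrt (F x) - μ) ^ 2 :=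
    Finset.sum_nonneg fun x _ => mul_nonneg ENNReal.toReal_nonneg (sq_nonneg _)
  have h1 : ∑ x ∈ S, (p x).toReal * (Real.sqrt (F x) - μ) ^ 2 =
      ∑ x ∈ S, (p x).toReal * F x - 2 * μ * ∑ x ∈ S, (p x).toReal * Real.sqrt (F x)
        + μ ^ 2 * ∑ x ∈ S, (p x).toReal := by
    simp only [Finset.mul_sum, ← Finset.sum_sub_distrib, ← Finset.sum_add_distrib]
    refine Finset.sum_congr rfl fun x _ => ?_
    rw [sub_sq, Real.sq_sqrt (hF x)]
    ring
  rw [h1, sum_toReal_eq_one hp, ← pmfMean_eq_sum hp, ← pmfMean_eq_sum hp, ← hμ] at h0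
  linarith

theorem pmfMean_pure (x : X) (F : X → ℝ) : pmfMean (PMF.pure x) F = F x := by
  rw [pmfMean_eq_sum (S := {x}) (by simp [PMF.support_pure])]
  simp

theorem pmfMean_bind (hp : p.support ⊆ S) {f : X → PMF Y} {T : Finset Y}
    (hf : ∀ x ∈ S, (f x).support ⊆ T) (F : Y → ℝ) :
    pmfMean (p.bind f) F = pmfMean p (fun x => pmfMean (f x) F) := by
  have hT : (p.bind f).support ⊆ T := by
    intro y hy
    obtain ⟨x, hx, hxy⟩ := (PMF.mem_support_bind_iff p f y).1 hy
    exact hf x (hp hx) hxy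
  have hval : ∀ y, ((p.bind f) y).toReal = ∑ x ∈ S, (p x).toReal * (f x y).toReal := by
    intro y
    rw [PMF.bind_apply, tsum_eq_sum (s := S), ENNReal.toReal_sum]
    · simp only [ENNReal.toReal_mul]
    · exact fun x _ => ENNReal.mul_ne_top (p.apply_ne_top x) ((f x).apply_ne_top y)
    · intro x hx
      have : p x = 0 := by
        by_contra h
        exact hx (hp ((PMF.mem_support_iff p x).2 h))
      simp [this]
  rw [pmfMean_eq_sum hT, pmfMean_eq_sum hp]
  simp only [hval, Finset.sum_mul]
  rw [Finset.sum_comm]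
  refine Finset.sum_congr rfl fun x hx => ?_
  rw [pmfMean_eq_sum (hf x hx), Finset.mul_sum]
  exact Finset.sum_congr rfl fun y _ => mul_assoc _ _ _

theorem pmfMean_map (hp : p.support ⊆ S) (h : X → Y) (F : Y → ℝ) :
    pmfMean (p.map h) F = pmfMean p (fun x => F (h x)) := by
  classical
  change pmfMean (p.bind (PMF.pure ∘ h)) F = _
  rw [pmfMean_bind hp (T := S.image h)]
  · simp only [Function.comp, pmfMean_pure]
  · intro x hx
    simp only [Function.comp, PMF.support_pure, Set.singleton_subset_iff]
    exact Finset.mem_coe.2 (Finset.mem_image_of_mem h hx)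

end Mean

section Law

variable {A : Type*} [Fintype A] {B : Type*} {ζ : Procedure A B} {D : Finset (Simplex A)}

theorem forecastLaw_support_subset (hζ : ζ.ForecastsIn D) :
    ∀ (t : ℕ) (a : Fin t → A) (b : Fin t → B),
      (forecastLaw ζ t a b).support ⊆ (Fintype.piFinset fun _ : Fin t => D : Finset _)
  | 0, a, b => fun _ _ =>
    Finset.mem_coe.2 (Fintype.mem_piFinset.2 fun s => s.elim0)
  | t + 1, a, b => by
    intro c hc
    simp only [forecastLaw, PMF.mem_support_bind_iff, PMF.mem_support_map_iff] at hc
    obtain ⟨c', hc', x, hx, rfl⟩ := hc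
    have ih := forecastLaw_support_subset hζ t _ _ hc'
    simp only [Finset.mem_coe, Fintype.mem_piFinset] at ih ⊢
    intro s
    refine Fin.lastCases ?_ (fun s => ?_) s
    · simpa using hζ _ _ _ _ hx
    · simpa using ih s

theorem expectation_succ (hζ : ζ.ForecastsIn D) {t : ℕ} (a : Fin (t + 1) → A)
    (b : Fin (t + 1) → B) (F : (Fin (t + 1) → Simplex A) → ℝ) :
    expectation ζ a b F =
      expectation ζ (fun s => a s.castSucc) (fun s => b s.castSucc) fun c =>
        pmfMean (ζ t (fun s => a s.castSucc) c b) fun x =>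
          F (Fin.snoc (α := fun _ => Simplex A) c x) := by
  change pmfMean (forecastLaw ζ (t + 1) a b) F = pmfMean _ _
  rw [forecastLaw, pmfMean_bind (forecastLaw_support_subset hζ t _ _)
    (T := Fintype.piFinset fun _ : Fin (t + 1) => D)]
  · congr 1
    funext c
    exact pmfMean_map (hζ _ _ _ _) _ _
  · intro c hc z hz
    simp only [PMF.mem_support_map_iff] at hz
    obtain ⟨x, hx, rfl⟩ := hz
    simp only [Finset.mem_coe, Fintype.mem_piFinset] at hc ⊢
    intro s
    refine Fin.lastCases ?_ (fun s => ?_) s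
    · simpa using hζ _ _ _ _ hx
    · simpa using hc s

end Law

end Forecast

/-! ### Proper scoring rules -/

namespace Forecast

variable {A : Type*} [Fintype A] {L : A → Simplex A → ℝ}

/-- The divergence of a `1`-bounded proper scoring rule is at most the Euclidean distance: by
properness it is at most the symmetrized divergence `⟨d - c, 𝐋(c) - 𝐋(d)⟩`. -/
theorem divergence_le_norm_sub (hL : L ∈ properOne A) (d c : Simplex A) :
    divergence L d c ≤ ‖d.1 - c.1‖ := by
  have h1 : divergence L d c ≤ inner ℝ (lossVec L c - lossVec L d) (d.1 - c.1) := by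
    have h := hL.1 d c
    have heq : inner ℝ (lossVec L c - lossVec L d) (d.1 - c.1) =
        (expLoss L d c - expLoss L d d) + (expLoss L c d - expLoss L c c) := by
      simp only [PiLp.inner_apply, lossVec, expLoss, PiLp.sub_apply, RCLike.inner_apply,
        conj_trivial, ← Finset.sum_sub_distrib, ← Finset.sum_add_distrib]
      exact Finset.sum_congr rfl fun i _ => by ring
    rw [heq, divergence]
    linarith
  calc divergence L d c ≤ _ := h1
    _ ≤ ‖lossVec L c - lossVec L d‖ * ‖d.1 - c.1‖ := real_inner_le_norm _ _
    _ ≤ 1 * ‖d.1 - c.1‖ := by gcongr; exact hL.2 c d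
    _ = _ := one_mul _

variable {I J : Type*} {t : ℕ}

/-- The expected loss is linear in the distribution, so at a bin mean it is the average loss over
the bin. -/
theorem expLoss_binMean (a : Fin t → A) (i : Fin t → I) (j : I) (hj : 0 < binCount i j)
    (y : Simplex A) :
    expLoss L (binMean a i j hj) y =
      (binCount i j : ℝ)⁻¹ * ∑ s ∈ binPeriods i j, expLoss L (vertex (a s)) y := by
  simp only [expLoss, binMean, PiLp.smul_apply, WithLp.ofLp_sum, Finset.sum_apply, smul_eq_mul,
    Finset.mul_sum, Finset.sum_mul]
  rw [Finset.sum_comm]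
  exact Finset.sum_congr rfl fun s _ => Finset.sum_congr rfl fun x _ => by ring

/-- For forecasts that are constant on the bins, replacing the actions by their bin means does not
change the total loss. -/
theorem sum_expLoss_binMean (a : Fin t → A) (i : Fin t → I) {φ : Fin t → Simplex A}
    (hφ : ∀ s s', i s = i s' → φ s = φ s') :
    ∑ s, expLoss L (vertex (a s)) (φ s) =
      ∑ s, expLoss L (binMean a i (i s) (binCount_pos i s)) (φ s) := by
  classical
  simp only [expLoss_binMean, Finset.mul_sum, binPeriods, Finset.sum_filter, mul_ite, mul_zero]
  rw [Finset.sum_comm]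
  refine Finset.sum_congr rfl fun s _ => ?_
  have hpos : (binCount i (i s) : ℝ) ≠ 0 := by exact_mod_cast (binCount_pos i s).ne'
  have : ∀ s', (if i s = i s' then (binCount i (i s') : ℝ)⁻¹ *
      expLoss L (vertex (a s)) (φ s') else 0) =
      if i s' = i s then (binCount i (i s) : ℝ)⁻¹ * expLoss L (vertex (a s)) (φ s) else 0 := by
    intro s'
    by_cases h : i s = i s'
    · rw [if_pos h, if_pos h.symm, ← h, hφ s s' h]
    · rw [if_neg h, if_neg (Ne.symm h)]
  simp only [this]
  rw [← Finset.sum_filter, Finset.sum_const, nsmul_eq_mul]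
  have hc : (Finset.univ.filter fun s' => i s' = i s).card = binCount i (i s) := by
    rw [binCount, binPeriods]
  rw [hc, ← mul_assoc, mul_inv_cancel₀ hpos, one_mul]

theorem binMean_congr (a : Fin t → A) (i : Fin t → I) {s s' : Fin t} (h : i s = i s') :
    binMean a i (i s) (binCount_pos i s) = binMean a i (i s') (binCount_pos i s') := by
  congr 1

/-- The calibration score is the excess of the Brier score over the refinement score, for every
binning that is at least as fine as the forecasts. -/
theorem brierScore_sub_refinementScore (a : Fin t → A) (c : Fin t → Simplex A) (i : Fin t → I)
    (hc : ∀ s s', i s = i s' → c s = c s') :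
    brierScore L a c - refinementScore L a i = calibrationScore L a c i := by
  simp only [brierScore, refinementScore, calibrationScore, divergence, ← mul_sub,
    Finset.sum_sub_distrib]
  rw [sum_expLoss_binMean a i hc,
    sum_expLoss_binMean a i (φ := fun s => binMean a i (i s) (binCount_pos i s))
      fun s s' h => binMean_congr a i h]
  ring

/-- A finer binning has a smaller refinement score. -/
theorem refinementScore_anti (hL : IsProper L) (a : Fin t → A) (i : Fin t → I) (i' : Fin t → J)
    (h : ∀ s s', i' s = i' s' → i s = i s') :
    refinementScore L a i' ≤ refinementScore L a i := by
  simp only [refinementScore, divergence, Finset.sum_sub_distrib]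
  refine mul_le_mul_of_nonneg_left (sub_le_sub_right ?_ _) (by positivity)
  rw [sum_expLoss_binMean a i' (φ := fun s => binMean a i' (i' s) (binCount_pos i' s))
      fun s s' h' => binMean_congr a i' h',
    sum_expLoss_binMean a i' (φ := fun s => binMean a i (i s) (binCount_pos i s))
      fun s s' h' => binMean_congr a i (h s s' h')]
  exact Finset.sum_le_sum fun s _ => hL _ _

/-- The calibration score of a `1`-bounded proper scoring rule is at most the root of the quadratic
calibration score. -/
theorem calibrationScore_le_sqrt (hL : L ∈ properOne A) (ht : 1 ≤ t) (a : Fin t → A)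
    (c : Fin t → Simplex A) (i : Fin t → I) :
    calibrationScore L a c i ≤ Real.sqrt ((1 / (t : ℝ)) *
      ∑ s, ‖(binMean a i (i s) (binCount_pos i s)).1 - (c s).1‖ ^ 2) := by
  have ht' : (0 : ℝ) < t := by exact_mod_cast ht
  set r : Fin t → ℝ := fun s => ‖(binMean a i (i s) (binCount_pos i s)).1 - (c s).1‖ with hr
  have h1 : calibrationScore L a c i ≤ (1 / (t : ℝ)) * ∑ s, r s := by
    unfold calibrationScore
    gcongr with s
    exact divergence_le_norm_sub hL _ _
  refine h1.trans (Real.le_sqrt_of_sq_le ?_)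
  have h2 : (∑ s, r s) ^ 2 ≤ t * ∑ s, r s ^ 2 := by
    simpa using sq_sum_le_card_mul_sum_sq (s := Finset.univ) (f := r)
  calc (1 / (t : ℝ) * ∑ s, r s) ^ 2 = (1 / (t : ℝ)) ^ 2 * (∑ s, r s) ^ 2 := by ring
    _ ≤ (1 / (t : ℝ)) ^ 2 * (t * ∑ s, r s ^ 2) := by gcongr
    _ = 1 / (t : ℝ) * ∑ s, r s ^ 2 := by field_simp

end Forecast

/-! ### The quadratic potential -/

namespace Forecast

variable {A : Type*} [Fintype A]

/-- Any two points of the simplex have squared distance at most `2`. -/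
theorem Simplex.norm_sub_sq_le_two (a g : Simplex A) : ‖a.1 - g.1‖ ^ 2 ≤ 2 := by
  have hle : ∀ (d : Simplex A) i, d.1 i ≤ 1 := fun d i =>
    (mem_Icc_of_mem_stdSimplex (f := fun i => d.1 i) d.2 i).2
  rw [EuclideanSpace.real_norm_sq_eq]
  calc ∑ i, (a.1 - g.1) i ^ 2 ≤ ∑ i, (a.1 i + g.1 i) := by
        refine Finset.sum_le_sum fun i _ => ?_
        rw [PiLp.sub_apply]
        nlinarith [mul_nonneg (a.2.1 i) (g.2.1 i),
          mul_nonneg (a.2.1 i) (sub_nonneg.2 (hle a i)),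
          mul_nonneg (g.2.1 i) (sub_nonneg.2 (hle g i))]
    _ = 2 := by rw [Finset.sum_add_distrib, a.2.2, g.2.2]; norm_num

/-- The effect on `‖V‖ ^ 2 / n`, where `V = n • (g - x)` is the sum of the deviations from `x` in a
bin with `n` entries and mean `g`, of adding the entry `a`. -/
theorem norm_sq_div_step {E : Type*} [NormedAddCommGroup E] [InnerProductSpace ℝ E] (n : ℕ)
    (a g x : E) :
    ‖(n : ℝ) • (g - x) + (a - x)‖ ^ 2 / ((n : ℝ) + 1) =
      ‖(n : ℝ) • (g - x)‖ ^ 2 / n + ‖a - x‖ ^ 2 - ‖a - g‖ ^ 2 + ‖a - g‖ ^ 2 / (n + 1) := by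
  have hag : a - g = (a - x) - (g - x) := by abel
  rw [hag]
  generalize a - x = w
  generalize g - x = u
  rcases Nat.eq_zero_or_pos n with rfl | hn
  · simp
  · have hn' : (n : ℝ) ≠ 0 := by positivity
    have hn1 : (n : ℝ) + 1 ≠ 0 := by positivity
    rw [norm_add_sq_real, norm_sub_sq_real, norm_smul, real_inner_smul_left, real_inner_comm,
      Real.norm_natCast]
    field_simp
    ring

variable {J : Type*} {t : ℕ}

open Classical in
theorem sum_binPeriods_succ {E : Type*} [AddCommMonoid E] (i : Fin (t + 1) → J) (j : J)
    (F : Fin (t + 1) → E) :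
    ∑ s ∈ binPeriods i j, F s = ∑ s ∈ binPeriods (fun s => i s.castSucc) j, F s.castSucc +
      if i (Fin.last t) = j then F (Fin.last t) else 0 := by
  simp only [binPeriods, Finset.sum_filter, Fin.sum_univ_castSucc]

open Classical in
theorem binCount_succ (i : Fin (t + 1) → J) (j : J) :
    binCount i j = binCount (fun s => i s.castSucc) j + if i (Fin.last t) = j then 1 else 0 := by
  simp only [binCount, Finset.card_eq_sum_ones]
  exact sum_binPeriods_succ i j fun _ => 1

/-- The total deviation of the actions from the point `x` in the bin `j`. -/
noncomputable def binDeviation (a : Fin t → A) (i : Fin t → J) (j : J) (x : Simplex A) :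
    EuclideanSpace ℝ A :=
  ∑ s ∈ binPeriods i j, ((vertex (a s)).1 - x.1)

theorem binDeviation_eq (a : Fin t → A) (i : Fin t → J) (j : J) (x : Simplex A)
    (hj : 0 < binCount i j) :
    binDeviation a i j x = (binCount i j : ℝ) • ((binMean a i j hj).1 - x.1) := by
  have hne : (binCount i j : ℝ) ≠ 0 := by exact_mod_cast hj.ne'
  rw [binDeviation, binMean, smul_sub, smul_inv_smul₀ hne, Finset.sum_sub_distrib,
    Finset.sum_const, ← Nat.cast_smul_eq_nsmul ℝ]
  rfl

open Classical in
/-- The average action in the bin `j`, or an arbitrary vertex if the bin is empty. -/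
noncomputable def binMeanOrVertex [Nonempty A] (a : Fin t → A) (i : Fin t → J) (j : J) :
    Simplex A :=
  if hj : 0 < binCount i j then binMean a i j hj else vertex (Classical.arbitrary A)

theorem binDeviation_eq_smul [Nonempty A] (a : Fin t → A) (i : Fin t → J) (j : J)
    (x : Simplex A) :
    binDeviation a i j x = (binCount i j : ℝ) • ((binMeanOrVertex a i j).1 - x.1) := by
  by_cases hj : 0 < binCount i j
  · rw [binMeanOrVertex, dif_pos hj, binDeviation_eq a i j x hj]
  · have h0 : binCount i j = 0 := by omega
    have : binPeriods i j = ∅ := Finset.card_eq_zero.1 h0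
    simp [binDeviation, this, h0]

/-- The squared deviations of the bin mean from `x` in the bin `j`, summed over the bin, less the
correction `2 * (1 + 1/2 + ⋯ + 1/n)` for the `n` entries of the bin. -/
noncomputable def binPotential (a : Fin t → A) (i : Fin t → J) (j : J) (x : Simplex A) : ℝ :=
  ‖binDeviation a i j x‖ ^ 2 / binCount i j - 2 * (harmonic (binCount i j) : ℝ)

theorem binPotential_succ_le [Nonempty A] (a : Fin (t + 1) → A) (i : Fin (t + 1) → J) (j : J)
    (x : Simplex A) (hj : i (Fin.last t) = j) :
    binPotential a i j x ≤ binPotential (fun s => a s.castSucc) (fun s => i s.castSucc) j x +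
      (‖(vertex (a (Fin.last t))).1 - x.1‖ ^ 2 - ‖(vertex (a (Fin.last t))).1 -
        (binMeanOrVertex (fun s => a s.castSucc) (fun s => i s.castSucc) j).1‖ ^ 2) := by
  set n := binCount (fun s : Fin t => i s.castSucc) j with hn
  set g := binMeanOrVertex (fun s => a s.castSucc) (fun s => i s.castSucc) j with hg
  have hV : binDeviation a i j x =
      (n : ℝ) • (g.1 - x.1) + ((vertex (a (Fin.last t))).1 - x.1) := by
    rw [binDeviation, sum_binPeriods_succ, if_pos hj]
    congr 1
    exact binDeviation_eq_smul (fun s => a s.castSucc) (fun s => i s.castSucc) j x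
  have hN : binCount i j = n + 1 := by rw [binCount_succ, if_pos hj]
  rw [binPotential, binPotential, hV, hN, binDeviation_eq_smul, ← hn, ← hg, harmonic_succ]
  push_cast
  rw [norm_sq_div_step]
  have h2 := Simplex.norm_sub_sq_le_two (vertex (a (Fin.last t))) g
  have h3 : ‖(vertex (a (Fin.last t))).1 - g.1‖ ^ 2 / ((n : ℝ) + 1) ≤ 2 / ((n : ℝ) + 1) := by
    gcongr
  rw [div_eq_mul_inv 2] at h3
  linarith

theorem binPotential_succ_of_ne (a : Fin (t + 1) → A) (i : Fin (t + 1) → J) (j : J)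
    (x : Simplex A) (hj : i (Fin.last t) ≠ j) :
    binPotential a i j x = binPotential (fun s => a s.castSucc) (fun s => i s.castSucc) j x := by
  rw [binPotential, binPotential, binCount_succ, if_neg hj, binDeviation, sum_binPeriods_succ,
    if_neg hj, add_zero, add_zero, binDeviation]

/-- If the forecasts are recorded in the bins, then the quadratic calibration score is a sum over
bins. -/
theorem sum_norm_binMean_sub_sq {B : Type*} [Fintype B] {D : Finset (Simplex A)}
    (a : Fin t → A) (b : Fin t → B) (c : Fin t → Simplex A) (hc : ∀ s, c s ∈ D) :
    ∑ s, ‖(binMean a (jointBin b c) (jointBin b c s) (binCount_pos _ s)).1 - (c s).1‖ ^ 2 =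
      ∑ j ∈ Finset.univ ×ˢ D, ‖binDeviation a (jointBin b c) j j.2‖ ^ 2 /
        binCount (jointBin b c) j := by
  classical
  rw [← Finset.sum_fiberwise_of_maps_to (g := jointBin b c) (t := Finset.univ ×ˢ D)
    fun s _ => by simp [jointBin, hc s]]
  refine Finset.sum_congr rfl fun j _ => ?_
  by_cases hj : 0 < binCount (jointBin b c) j
  · have hne : (binCount (jointBin b c) j : ℝ) ≠ 0 := by exact_mod_cast hj.ne'
    have hterm : ∀ s ∈ Finset.univ.filter (fun s => jointBin b c s = j),
        ‖(binMean a (jointBin b c) (jointBin b c s) (binCount_pos _ s)).1 - (c s).1‖ ^ 2 =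
          ‖(binMean a (jointBin b c) j hj).1 - j.2.1‖ ^ 2 := by
      intro s hs
      obtain rfl := (Finset.mem_filter.1 hs).2
      rfl
    rw [Finset.sum_congr rfl hterm, Finset.sum_const, nsmul_eq_mul,
      binDeviation_eq a _ j j.2 hj, norm_smul, Real.norm_natCast]
    have hcard : (Finset.univ.filter fun s => jointBin b c s = j).card =
        binCount (jointBin b c) j := by
      rw [binCount, binPeriods]
      congr
    rw [hcard]
    field_simp
  · have h0 : binCount (jointBin b c) j = 0 := by omega
    have hemp : Finset.univ.filter (fun s => jointBin b c s = j) = ∅ := by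
      rw [Finset.filter_eq_empty_iff]
      intro s _ hs
      exact hj (hs ▸ binCount_pos _ s)
    rw [hemp, h0]
    simp

end Forecast

/-! ### The asymptotic bound -/

namespace Forecast

/-- Uniform bounds on expected scores which converge to `δ` give the asymptotic bound. -/
theorem limsup_iSup_le {A : Type*} [Fintype A] {B : Type*} {δ K : ℝ} (hδ : 0 < δ)
    {G : ∀ t : ℕ, (A → Simplex A → ℝ) → (Fin t → A) → (Fin t → B) → ℝ}
    (hG : ∀ t : ℕ, 1 ≤ t → ∀ (a : Fin t → A) (b : Fin t → B), ∀ L ∈ properOne A,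
      G t L a b ≤ Real.sqrt (δ ^ 2 + K * ((Real.log t + 1) / t))) :
    limsup (fun t : ℕ => ⨆ L ∈ properOne A, ⨆ (a : Fin t → A) (b : Fin t → B),
      ((G t L a b : ℝ) : EReal)) atTop ≤ ((Real.sqrt δ ^ 2 : ℝ) : EReal) := by
  have h0 : Tendsto (fun t : ℕ => (Real.log t + 1) / (t : ℝ)) atTop (nhds 0) := by
    have h1 : Tendsto (fun x : ℝ => Real.log x ^ 1 / (1 * x + 0)) atTop (nhds 0) :=
      Real.tendsto_pow_log_div_mul_add_atTop 1 0 1 one_ne_zero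
    simp only [pow_one, one_mul, add_zero] at h1
    have h2 : Tendsto (fun t : ℕ => 1 / (t : ℝ)) atTop (nhds 0) :=
      tendsto_one_div_atTop_nhds_zero_nat
    simpa [add_div] using (h1.comp tendsto_natCast_atTop_atTop).add h2
  have hlim : Tendsto (fun t : ℕ => Real.sqrt (δ ^ 2 + K * ((Real.log t + 1) / t))) atTop
      (nhds (Real.sqrt δ ^ 2)) := by
    have := ((h0.const_mul K).const_add (δ ^ 2)).sqrt
    rw [mul_zero, add_zero, Real.sqrt_sq hδ.le] at this
    rwa [Real.sq_sqrt hδ.le]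
  have hlimE := (continuous_coe_real_ereal.tendsto _).comp hlim
  rw [← hlimE.limsup_eq]
  refine limsup_le_limsup ?_
  filter_upwards [eventually_ge_atTop 1] with t ht
  refine iSup₂_le fun L hL => iSup₂_le fun a b => ?_
  exact EReal.coe_le_coe_iff.2 (hG t ht a b L hL)

end Forecast

/-! ### The forecasting procedure -/

namespace Forecast

variable {A : Type*} [Fintype A] [Nonempty A] {B : Type*}

/-- The weights of `exists_outgoing_weights` as a probability distribution. -/
theorem exists_outgoing_pmf {δ : ℝ} {D : Finset (Simplex A)}
    (hgrid : IsGrid δ D) (g : Simplex A → Simplex A) :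
    ∃ p : PMF (Simplex A), p.support ⊆ D ∧ (∃ y, p.support ⊆ Metric.closedBall y δ) ∧
      ∀ a : Simplex A, pmfMean p (fun c => ‖a.1 - c.1‖ ^ 2 - ‖a.1 - (g c).1‖ ^ 2) ≤ δ ^ 2 := by
  obtain ⟨y, w, hw0, hwD, hw1, hball, hout⟩ := exists_outgoing_weights hgrid g
  let p : PMF (Simplex A) := PMF.ofFinset (fun c => ENNReal.ofReal (w c)) D
    (by rw [← ENNReal.ofReal_sum_of_nonneg fun c _ => hw0 c, hw1, ENNReal.ofReal_one])
    fun c hc => by rw [hwD c hc, ENNReal.ofReal_zero]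
  have hp : ∀ c, p c = ENNReal.ofReal (w c) := fun c => rfl
  have hne : ∀ c ∈ p.support, w c ≠ 0 := by
    intro c hc h
    rw [PMF.mem_support_iff, hp, h, ENNReal.ofReal_zero] at hc
    exact hc rfl
  have hD : p.support ⊆ D := fun c hc => by
    by_contra h
    exact hne c hc (hwD c h)
  refine ⟨p, hD, ⟨y, fun c hc => hball c (hne c hc)⟩, fun a => ?_⟩
  rw [pmfMean_eq_sum hD]
  simp only [hp, ENNReal.toReal_ofReal (hw0 _)]
  exact hout a

/-- The procedure which in each period randomizes over the forecasts `c` as in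
`exists_outgoing_pmf`, where `g c` is the current average action in the joint bin of `c` and the
current reference forecast. -/
noncomputable def outgoingProcedure {δ : ℝ} {D : Finset (Simplex A)} (hgrid : IsGrid δ D) :
    Procedure A B := fun n a c b =>
  (exists_outgoing_pmf hgrid fun x =>
    binMeanOrVertex a (jointBin (fun s : Fin n => b s.castSucc) c) (b (Fin.last n), x)).choose

variable {δ : ℝ} {D : Finset (Simplex A)}

theorem outgoingProcedure_forecastsIn (hgrid : IsGrid δ D) :
    (outgoingProcedure hgrid : Procedure A B).ForecastsIn D := fun n a c b =>
  (exists_outgoing_pmf hgrid fun x =>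
    binMeanOrVertex a (jointBin (fun s : Fin n => b s.castSucc) c)
      (b (Fin.last n), x)).choose_spec.1

theorem outgoingProcedure_isAlmostDeterministic (hgrid : IsGrid δ D) :
    (outgoingProcedure hgrid : Procedure A B).IsAlmostDeterministic δ := fun n a c b =>
  (exists_outgoing_pmf hgrid fun x =>
    binMeanOrVertex a (jointBin (fun s : Fin n => b s.castSucc) c)
      (b (Fin.last n), x)).choose_spec.2.1

theorem outgoingProcedure_mean_le (hgrid : IsGrid δ D) {n : ℕ} (a : Fin n → A)
    (c : Fin n → Simplex A) (b : Fin (n + 1) → B) (a' : Simplex A) :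
    pmfMean (outgoingProcedure hgrid n a c b) (fun x => ‖a'.1 - x.1‖ ^ 2 -
      ‖a'.1 - (binMeanOrVertex a (jointBin (fun s : Fin n => b s.castSucc) c)
        (b (Fin.last n), x)).1‖ ^ 2) ≤ δ ^ 2 :=
  (exists_outgoing_pmf hgrid fun x =>
    binMeanOrVertex a (jointBin (fun s : Fin n => b s.castSucc) c)
      (b (Fin.last n), x)).choose_spec.2.2 a'

/-- The expected potential grows by at most `δ ^ 2` per period. -/
theorem expectation_sum_binPotential_le [Fintype B] (hgrid : IsGrid δ D) :
    ∀ (t : ℕ) (a : Fin t → A) (b : Fin t → B),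
      expectation (outgoingProcedure hgrid) a b (fun c => ∑ j ∈ Finset.univ ×ˢ D,
        binPotential a (jointBin b c) j j.2) ≤ t * δ ^ 2
  | 0, a, b => by
    have h : ∀ c : Fin 0 → Simplex A, ∑ j ∈ Finset.univ ×ˢ D,
        binPotential a (jointBin b c) j j.2 = 0 := fun c =>
      Finset.sum_eq_zero fun j _ => by
        simp [binPotential, binDeviation, binCount, binPeriods]
    simp [expectation, h]
  | t + 1, a, b => by
    classical
    have hζ := outgoingProcedure_forecastsIn (B := B) hgrid
    have ih := expectation_sum_binPotential_le hgrid t (fun s => a s.castSucc)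
      (fun s => b s.castSucc)
    rw [expectation_succ hζ]
    have hstep : ∀ c : Fin t → Simplex A,
        pmfMean (outgoingProcedure hgrid t (fun s => a s.castSucc) c b) (fun x =>
          ∑ j ∈ Finset.univ ×ˢ D, binPotential a
            (jointBin b (Fin.snoc (α := fun _ => Simplex A) c x)) j j.2) ≤
        ∑ j ∈ Finset.univ ×ˢ D, binPotential (fun s => a s.castSucc)
          (jointBin (fun s => b s.castSucc) c) j j.2 + δ ^ 2 := by
      intro c
      refine le_trans (pmfMean_mono (hζ _ _ _ _)
        (G := fun x => (‖(vertex (a (Fin.last t))).1 - x.1‖ ^ 2 -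
          ‖(vertex (a (Fin.last t))).1 - (binMeanOrVertex (fun s => a s.castSucc)
            (jointBin (fun s => b s.castSucc) c) (b (Fin.last t), x)).1‖ ^ 2) +
          ∑ j ∈ Finset.univ ×ˢ D, binPotential (fun s => a s.castSucc)
            (jointBin (fun s => b s.castSucc) c) j j.2) fun x hx => ?_) ?_
      · set i := jointBin b (Fin.snoc (α := fun _ => Simplex A) c x) with hi
        have hlast : i (Fin.last t) = (b (Fin.last t), x) := by simp [hi, jointBin]
        have hinit : (fun s : Fin t => i s.castSucc) = jointBin (fun s => b s.castSucc) c := by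
          funext s
          simp [hi, jointBin]
        have hmem : (b (Fin.last t), x) ∈ (Finset.univ : Finset B) ×ˢ D := by simp [hx]
        rw [← Finset.add_sum_erase _ _ hmem, ← Finset.add_sum_erase _ _ hmem, ← hinit]
        have h1 := binPotential_succ_le a i (b (Fin.last t), x) x hlast
        have h2 : ∑ j ∈ ((Finset.univ : Finset B) ×ˢ D).erase (b (Fin.last t), x),
            binPotential a i j j.2 = ∑ j ∈ ((Finset.univ : Finset B) ×ˢ D).erase
              (b (Fin.last t), x), binPotential (fun s => a s.castSucc)
                (fun s => i s.castSucc) j j.2 :=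
          Finset.sum_congr rfl fun j hj => binPotential_succ_of_ne a i j j.2
            (hlast ▸ (Finset.mem_erase.1 hj).1.symm)
        rw [h2]
        linarith
      · rw [pmfMean_add_const (hζ _ _ _ _)]
        have := outgoingProcedure_mean_le hgrid (fun s => a s.castSucc) c b
          (vertex (a (Fin.last t)))
        linarith
    have hsupp := forecastLaw_support_subset hζ t (fun s => a s.castSucc) (fun s => b s.castSucc)
    refine (pmfMean_mono hsupp fun c _ => hstep c).trans ?_
    rw [pmfMean_add_const hsupp]
    change expectation _ _ _ _ + _ ≤ _
    push_cast
    linarith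

/-- The expected quadratic calibration score with respect to the joint binning. -/
theorem expectation_sum_norm_sq_le [Fintype B] (hgrid : IsGrid δ D) {t : ℕ} (ht : 1 ≤ t)
    (a : Fin t → A) (b : Fin t → B) :
    expectation (outgoingProcedure hgrid) a b (fun c => (1 / (t : ℝ)) *
      ∑ s, ‖(binMean a (jointBin b c) (jointBin b c s) (binCount_pos _ s)).1 - (c s).1‖ ^ 2) ≤
      δ ^ 2 + 2 * (Fintype.card B : ℝ) * (D.card : ℝ) * ((Real.log t + 1) / t) := by
  have ht' : (0 : ℝ) < t := by exact_mod_cast ht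
  have hζ := outgoingProcedure_forecastsIn (B := B) hgrid
  have hsupp := forecastLaw_support_subset hζ t a b
  have hpt : ∀ c ∈ (Fintype.piFinset fun _ : Fin t => D), ∑ s,
      ‖(binMean a (jointBin b c) (jointBin b c s) (binCount_pos _ s)).1 - (c s).1‖ ^ 2 ≤
      ∑ j ∈ Finset.univ ×ˢ D, binPotential a (jointBin b c) j j.2 +
        2 * (Fintype.card B : ℝ) * (D.card : ℝ) * (Real.log t + 1) := by
    intro c hc
    rw [sum_norm_binMean_sub_sq a b c (Fintype.mem_piFinset.1 hc)]
    have hle : ∀ j ∈ (Finset.univ : Finset B) ×ˢ D, ‖binDeviation a (jointBin b c) j j.2‖ ^ 2 /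
        binCount (jointBin b c) j ≤
          binPotential a (jointBin b c) j j.2 + 2 * (Real.log t + 1) := by
      intro j _
      have h1 : (harmonic (binCount (jointBin b c) j) : ℝ) ≤ (harmonic t : ℝ) := by
        have hcard : binCount (jointBin b c) j ≤ t := 
          (Finset.card_le_univ (binPeriods (jointBin b c) j)).trans_eq (Fintype.card_fin t)
        have : harmonic (binCount (jointBin b c) j) ≤ harmonic t := by
          unfold harmonic
          exact Finset.sum_le_sum_of_subset_of_nonneg (Finset.range_mono hcard)
            fun i _ _ => by positivity
        exact_mod_cast this
      have h2 := harmonic_le_one_add_log t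
      rw [binPotential]
      linarith
    refine (Finset.sum_le_sum hle).trans_eq ?_
    rw [Finset.sum_add_distrib, Finset.sum_const, Finset.card_product, Finset.card_univ,
      nsmul_eq_mul]
    push_cast
    ring
  have hmain := expectation_sum_binPotential_le hgrid t a b
  calc expectation (outgoingProcedure hgrid) a b _
      = (1 / (t : ℝ)) * expectation (outgoingProcedure hgrid) a b (fun c =>
          ∑ s, ‖(binMean a (jointBin b c) (jointBin b c s) (binCount_pos _ s)).1
            - (c s).1‖ ^ 2) := pmfMean_const_mul _ _ _
    _ ≤ (1 / (t : ℝ)) * (t * δ ^ 2 +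
          2 * (Fintype.card B : ℝ) * (D.card : ℝ) * (Real.log t + 1)) := by
        refine mul_le_mul_of_nonneg_left ?_ (by positivity)
        refine (pmfMean_mono hsupp hpt).trans ?_
        rw [pmfMean_add_const hsupp]
        exact add_le_add_left hmain _
    _ = _ := by field_simp

/-- The bound for the calibration score with respect to the joint binning, from which the other
bounds follow since coarser binnings have larger refinement scores. -/
theorem expectation_calibrationScore_joint_le [Fintype B] (hgrid : IsGrid δ D) {t : ℕ}
    (ht : 1 ≤ t) (a : Fin t → A) (b : Fin t → B) {L : A → Simplex A → ℝ}
    (hL : L ∈ properOne A) :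
    expectation (outgoingProcedure hgrid) a b
        (fun c => calibrationScore L a c (jointBin b c)) ≤
      Real.sqrt (δ ^ 2 + 2 * (Fintype.card B : ℝ) * (D.card : ℝ) * ((Real.log t + 1) / t)) := by
  have hsupp := forecastLaw_support_subset (outgoingProcedure_forecastsIn (B := B) hgrid) t a b
  refine (pmfMean_mono hsupp fun c _ =>
    calibrationScore_le_sqrt hL ht a c (jointBin b c)).trans ?_
  refine (pmfMean_sqrt_le hsupp fun c => by positivity).trans ?_
  exact Real.sqrt_le_sqrt (expectation_sum_norm_sq_le hgrid ht a b)

end Forecast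

theorem mainTheorem2 {A : Type*} [Fintype A] [Nonempty A] {B : Type*} [Fintype B]
    (δ : ℝ) (hδ : 0 < δ) (Cδ : Finset (Forecast.Simplex A)) (hgrid : Forecast.IsGrid δ Cδ) :
    ∃ ζ : Forecast.Procedure A B,
      ζ.ForecastsIn Cδ ∧
      ζ.IsAlmostDeterministic δ ∧
      ζ.IsProperCalibeating (Real.sqrt δ) ∧
      ζ.IsProperCalibrated (Real.sqrt δ) ∧
      ∀ t : ℕ, 1 ≤ t → ∀ (a : Fin t → A) (b : Fin t → B), ∀ L ∈ Forecast.properOne A,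
        Forecast.expectation ζ a b (fun c => Forecast.brierScore L a c
            - Forecast.refinementScore L a (Forecast.jointBin b c))
          ≤ Real.sqrt (δ ^ 2 + 2 * (Fintype.card B : ℝ) * (Cδ.card : ℝ)
              * ((Real.log t + 1) / t)) ∧
        Forecast.expectation ζ a b (fun c => Forecast.brierScore L a c
            - Forecast.refinementScore L a b)
          ≤ Real.sqrt (δ ^ 2 + 2 * (Fintype.card B : ℝ) * (Cδ.card : ℝ)
              * ((Real.log t + 1) / t)) ∧
        Forecast.expectation ζ a b (fun c => Forecast.calibrationScore L a c c)
          = Forecast.expectation ζ a b (fun c => Forecast.brierScore L a c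
            - Forecast.refinementScore L a c) ∧
        Forecast.expectation ζ a b (fun c => Forecast.calibrationScore L a c c)
          ≤ Real.sqrt (δ ^ 2 + 2 * (Fintype.card B : ℝ) * (Cδ.card : ℝ)
              * ((Real.log t + 1) / t)) := by
  set ζ : Forecast.Procedure A B := Forecast.outgoingProcedure hgrid with hζdef
  have hζ : ζ.ForecastsIn Cδ := Forecast.outgoingProcedure_forecastsIn hgrid
  have hsupp := fun t (a : Fin t → A) (b : Fin t → B) =>
    Forecast.forecastLaw_support_subset hζ t a b
  have hfact : ∀ {t : ℕ} (b : Fin t → B) (c : Fin t → Forecast.Simplex A) (s s' : Fin t),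
      Forecast.jointBin b c s = Forecast.jointBin b c s' → b s = b s' ∧ c s = c s' :=
    fun b c s s' h => Prod.mk.inj h
  have hjoint : ∀ {t : ℕ} (a : Fin t → A) (b : Fin t → B) (c : Fin t → Forecast.Simplex A)
      (L : A → Forecast.Simplex A → ℝ), Forecast.brierScore L a c
        - Forecast.refinementScore L a (Forecast.jointBin b c) =
        Forecast.calibrationScore L a c (Forecast.jointBin b c) := fun a b c L =>
    Forecast.brierScore_sub_refinementScore a c _ fun s s' h => (hfact b c s s' h).2
  have hself : ∀ {t : ℕ} (a : Fin t → A) (c : Fin t → Forecast.Simplex A)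
      (L : A → Forecast.Simplex A → ℝ), Forecast.brierScore L a c
        - Forecast.refinementScore L a c = Forecast.calibrationScore L a c c := fun a c L =>
    Forecast.brierScore_sub_refinementScore a c c fun s s' h => h
  have hJ : ∀ t : ℕ, 1 ≤ t → ∀ (a : Fin t → A) (b : Fin t → B), ∀ L ∈ Forecast.properOne A,
      Forecast.expectation ζ a b (fun c => Forecast.brierScore L a c
          - Forecast.refinementScore L a (Forecast.jointBin b c))
        ≤ Real.sqrt (δ ^ 2 + 2 * (Fintype.card B : ℝ) * (Cδ.card : ℝ)
            * ((Real.log t + 1) / t)) := by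
    intro t ht a b L hL
    simp only [hjoint]
    exact Forecast.expectation_calibrationScore_joint_le hgrid ht a b hL
  have hB : ∀ t : ℕ, 1 ≤ t → ∀ (a : Fin t → A) (b : Fin t → B), ∀ L ∈ Forecast.properOne A,
      Forecast.expectation ζ a b (fun c => Forecast.brierScore L a c
          - Forecast.refinementScore L a b)
        ≤ Real.sqrt (δ ^ 2 + 2 * (Fintype.card B : ℝ) * (Cδ.card : ℝ)
            * ((Real.log t + 1) / t)) := fun t ht a b L hL =>
    le_trans (Forecast.pmfMean_mono (hsupp t a b) fun c _ => sub_le_sub_left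
      (Forecast.refinementScore_anti hL.1 a b (Forecast.jointBin b c)
        fun s s' h => (hfact b c s s' h).1) _) (hJ t ht a b L hL)
  have hK : ∀ t : ℕ, 1 ≤ t → ∀ (a : Fin t → A) (b : Fin t → B), ∀ L ∈ Forecast.properOne A,
      Forecast.expectation ζ a b (fun c => Forecast.calibrationScore L a c c)
        ≤ Real.sqrt (δ ^ 2 + 2 * (Fintype.card B : ℝ) * (Cδ.card : ℝ)
            * ((Real.log t + 1) / t)) := by
    intro t ht a b L hL
    simp only [← hself]
    exact le_trans (Forecast.pmfMean_mono (hsupp t a b) fun c _ => sub_le_sub_left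
      (Forecast.refinementScore_anti hL.1 a c (Forecast.jointBin b c)
        fun s s' h => (hfact b c s s' h).2) _) (hJ t ht a b L hL)
  refine ⟨ζ, hζ, Forecast.outgoingProcedure_isAlmostDeterministic hgrid,
    Forecast.limsup_iSup_le hδ hB, Forecast.limsup_iSup_le hδ hK,
    fun t ht a b L hL => ⟨hJ t ht a b L hL, hB t ht a b L hL, ?_, hK t ht a b L hL⟩⟩
  simp only [hself]
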